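/- **Definitions.** Let $F_n$ be the set of all functions $f:\{0,1\}^n\to\{-1,1\}$. A threshold gate with real weights $w$ and real threshold $\theta$ outputs $1$ iff $\sum_i w_i x_i\ge\theta$, and $0$ otherwise; a majority gate of fan-in $m$ is the threshold gate with all weights $1$ and threshold $m/2$. For real $s$, $\mathrm{Maj}_s\circ\mathrm{Thr}$ is the class of functions computed by a majority gate of fan-in at most $s$ applied to threshold gates that read the $n$ inputs (output bits $1,0$ standing for the values $1,-1$). A sequence $Q=(Q_n)_{n\in\mathbb N}$, $Q_n\subseteq F_n$, is a *natural property for $\Lambda$ with density $\delta$* if 1. (constructivity) a Turing machine given the truth table of $f\in F_n$ (a string of $2^n$ bits) decides whether $f\in Q_n$ in time polynomial in $2^n$; 2. (largeness) $|Q_n|\ge\delta\,|F_n|$ for every $n$; 3. (usefulness) for every sequence $f_n\in F_n$, for all but finitely many $n$: if $f_n\in\Lambda$ then $f_n\notin Q_n$. For a partition $P_n$ of the $n$ inputs into $A,B$ with $|A|=\lceil n/2\rceil$, $|B|=\lfloor n/2\rfloor$, write $x_1\|x_2$ for the input with $A$-part $x_1$ and $B$-part $x_2$, and let $$R_2(f)=\mathbb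 E_{x_1^0,x_1^1\in\{0,1\}^{A},\;x_2^0,x_2^1\in\{0,1\}^{B}}\ \prod_{b_1,b_2\in\{0,1\}} f\big(x_1^{b_1}\|x_2^{b_2}\big).$$ *Nisan's property* for $P=(P_n)_n$ is $N^P_n=\{f\in F_n:\ |2^n R_2(f)|\le 2^{2n/3}\}$. Let $H$ be the sequence of partitions in which $A$ consists of the first $\lceil n/2\rceil$ inputs. **Theorem.** There are natural numbers $c>0$ and $n_0$ such that: 1. for every sequence $P$ of such balanced partitions, $|N^P_n|\ge\frac12|F_n|$ for all $n\ge n_0$, and $N^P$ is useful against $\mathrm{Maj}_{2^{n/c}}\circ\mathrm{Thr}$ (in the sense of 3 above); 2. $N^H$ is constructive (in the sense of 1 above); 3. the sequence $Q$ with $Q_n=N^H_n$ for $n\ge n_0$ and $Q_n=F_n$ for $n<n_0$ is a natural property for $\mathrm{Maj}_{2^{n/c}}\circ\mathrm{Thr}$ with density $1/2$. -/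

import Mathlib

open scoped BigOperators

namespace MajThrNat

noncomputable section

/-- Boolean functions `{0,1}ⁿ → {-1,1}`; `ℤˣ` is the two-element set `{1, -1}`. -/
abbrev BoolFn (n : ℕ) : Type := (Fin n → Bool) → ℤˣ

/-! ### Majority-of-threshold circuits -/

/-- The linear threshold gate `∑ wᵢ xᵢ ≥ θ` with real weights and real threshold. -/
def thrGate {m : ℕ} (w : Fin m → ℝ) (θ : ℝ) (x : Fin m → Bool) : Bool :=
  open Classical in decide (θ ≤ ∑ i, w i * (if x i then 1 else 0))

/-- The majority gate of fan-in `m`: all weights are `1` and the threshold is `m / 2`. -/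
def majGate {m : ℕ} (y : Fin m → Bool) : Bool :=
  thrGate (fun _ => 1) ((m : ℝ) / 2) y

/-- The `{-1,1}` form of an output bit: `1 ↦ 1`, `0 ↦ -1`. -/
def signOf (b : Bool) : ℤˣ := if b then 1 else -1

/-- `n`-input functions computed by a majority of threshold circuit, i.e. by a majority gate of
fan-in `m ≤ s` whose inputs are the outputs of threshold gates reading the `n` inputs. -/
def majThr (s : ℝ) (n : ℕ) : Set (BoolFn n) :=
  {f | ∃ m : ℕ, (m : ℝ) ≤ s ∧ ∃ (w : Fin m → Fin n → ℝ) (θ : Fin m → ℝ),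
    ∀ x, f x = signOf (majGate fun j => thrGate (w j) (θ j) x)}

/-! ### Natural properties -/

/-- The truth table of `f`, a string of `2 ^ n` bits in lexicographic order: bit `k` is the value
(`1` for `1`, `0` for `-1`) of `f` at the binary expansion of `k`, the first input being the most
significant digit. -/
def truthTable {n : ℕ} (f : BoolFn n) : List Bool :=
  List.ofFn fun k : Fin (2 ^ n) => decide (f (fun i => (k : ℕ).testBit (n - 1 - i)) = 1)

/-- Constructivity: a Turing machine which is given the truth table of a function `f` on `n` inputs
decides whether `f ∈ Q n`, in time polynomial in the length `2 ^ n` of the truth table. -/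
def Constructive (Q : ∀ n, Set (BoolFn n)) : Prop :=
  open Classical in
  Nonempty (Turing.TM2ComputableInPolyTime
    (fun p : (Σ n, BoolFn n) => truthTable p.2) Computability.encodeBool
    (fun p : (Σ n, BoolFn n) => decide (p.2 ∈ Q p.1)))

/-- Largeness at input length `n`: the set contains at least a `δ` fraction of all functions. -/
def LargeAt {n : ℕ} (δ : ℝ) (Q : Set (BoolFn n)) : Prop :=
  δ * (Nat.card (BoolFn n) : ℝ) ≤ (Q.ncard : ℝ)

/-- Usefulness against `Λ`: for every sequence of functions `f n`, for all but finitely many `n`,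
if `f n` is in `Λ` then it is not in the property. -/
def Useful (Λ Q : ∀ n, Set (BoolFn n)) : Prop :=
  ∀ f : ∀ n, BoolFn n, ∀ᶠ n in Filter.atTop, f n ∈ Λ n → f n ∉ Q n

/-- `Q` is a natural property for `Λ` with density `δ`. -/
structure IsNaturalProperty (Λ : ∀ n, Set (BoolFn n)) (δ : ℕ → ℝ)
    (Q : ∀ n, Set (BoolFn n)) : Prop where
  constructive : Constructive Q
  large : ∀ n, LargeAt (δ n) (Q n)
  useful : Useful Λ Q

/-! ### Nisan's property -/

/-- A partition of the `n` inputs into `A` with `⌈n / 2⌉` elements and its complement `B`, which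
then has `⌊n / 2⌋` elements. -/
structure BalancedPartition (n : ℕ) where
  A : Finset (Fin n)
  card_A : A.card = (n + 1) / 2

/-- The partition in which `A` consists of the first `⌈n / 2⌉` inputs. -/
def firstHalf (n : ℕ) : BalancedPartition n where
  A := Finset.univ.filter fun i => (i : ℕ) < (n + 1) / 2
  card_A := by
    rw [Fin.card_filter_val_lt]
    omega

/-- The input `x₁ || x₂` whose `A`-part is `x₁` and whose `B`-part is `x₂`. -/
def merge {n : ℕ} (P : BalancedPartition n) (x₁ : {i // i ∈ P.A} → Bool)
    (x₂ : {i // i ∉ P.A} → Bool) : Fin n → Bool :=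
  fun i => if h : i ∈ P.A then x₁ ⟨i, h⟩ else x₂ ⟨i, h⟩

/-- The 2-party norm `R₂(f)` with respect to a partition of the inputs: the expectation, over
independent uniform `x₁⁰, x₁¹` and `x₂⁰, x₂¹`, of the product of the four values
`f (x₁^b₁ || x₂^b₂)`. Here `x₁ b` stands for `x₁ᵇ`, and similarly for `x₂`. -/
def twoPartyNorm {n : ℕ} (P : BalancedPartition n) (f : BoolFn n) : ℝ :=
  𝔼 x₁ : Bool → {i // i ∈ P.A} → Bool, 𝔼 x₂ : Bool → {i // i ∉ P.A} → Bool,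
    ∏ b₁ : Bool, ∏ b₂ : Bool, (((f (merge P (x₁ b₁) (x₂ b₂)) : ℤˣ) : ℤ) : ℝ)

/-- Nisan's property: the functions with `|2ⁿ · R₂(f)| ≤ 2^(2n/3)`. -/
def nisanProperty (P : ∀ n, BalancedPartition n) (n : ℕ) : Set (BoolFn n) :=
  {f | |(2 : ℝ) ^ n * twoPartyNorm (P n) f| ≤ (2 : ℝ) ^ (2 * (n : ℝ) / 3)}

end

end MajThrNat

open MajThrNat

namespace MajThrNat

/-! ### A structured language for stack machines -/

/-! A partition turns `f` into a sign matrix F with 2^⌈n/2⌉ rows and 2^⌊n/2⌋ columns. Then 4^n R₂(f)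
is `boxSum` F, the sum over all rectangles of the product of the four corners. It is a sum of
squares, so Nisan's property says that `boxSum` F ≤ 2^(5n/3) (`mem_nisanProperty_iff`).

Usefulness: two applications of Cauchy-Schwarz bound the correlation of F with bounded rank-one
matrices by D, where D^4 = 4^n `boxSum` F (`exists_rankOneBound`). A threshold gate is a comparison
h(b) ≤ g(a). After replacing values by ranks, the leading bit where two ranks differ writes it as
n/2 + 1 block-diagonal pieces. Each piece is an average of rank-one matrices over random signs, so a
gate has correlation at most (n/2 + 1) D (`RankOneBound.le`). A majority of m gates correlates with
its own shifted vote count by at least 2^n / 2, hence 2^n ≤ m poly(n) D (`le_boxSum_of_majority`).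
For m ≤ 2^(n/24) this contradicts `boxSum` F ≤ 2^(5n/3) when n is large.

Largeness: for random f a rectangle with distinct rows and distinct columns has mean 0, so the mean
of `boxSum` is at most 2^n (2^⌈n/2⌉ + 2^⌊n/2⌋), and Markov's inequality applies
(`large_nisanProperty`).

Constructivity: for the first-half partition the truth table is F read row by row. With N = 2^n,
`boxSum` F is twice the number of even rectangles minus N², and the test is (`boxSum` F)³ ≤ N⁵, free
of real powers. A program with unary counters carries it out in loops of polynomial length
(`exec_nisanProg`), and programs compile to stack machines with polynomial overhead (`Exec.runsIn`,
`computableInPolyTime`). -/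

/-- Structured programs over a family `V` of stackMap of bits. `case x p` continues with `p o`, where
`o` is the top of the stack `x`, and `loop x p` runs `p b` for the successive entries `b` which the
stack `x` has at the start of the loop, from the top to the bottom. -/
inductive Prog (V : Type) : Type
  | skip : Prog V
  | push : V → Bool → Prog V
  | pop : V → Prog V
  | seq : Prog V → Prog V → Prog V
  | case : V → (Option Bool → Prog V) → Prog V
  | loop : V → (Bool → Prog V) → Prog V

namespace Prog

variable {V : Type}

/-- `p.Exec B s s'`: the program `p` leads from the store `s` to the store `s'`, and every loop on
the way has at most `B` rounds. -/
inductive Exec [DecidableEq V] (B : ℕ) : Prog V → (V → List Bool) → (V → List Bool) → Prop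
  | skip (s) : Exec B skip s s
  | push (x b s) : Exec B (push x b) s (Function.update s x (b :: s x))
  | pop (x s) : Exec B (pop x) s (Function.update s x (s x).tail)
  | seq {p q s₁ s₂ s₃} : Exec B p s₁ s₂ → Exec B q s₂ s₃ → Exec B (seq p q) s₁ s₃
  | case {x p s s'} : Exec B (p (s x).head?) s s' → Exec B (case x p) s s'
  | loop {x p} (g : ℕ → V → List Bool) : (g 0 x).length ≤ B →
      (∀ t (h : t < (g 0 x).length), Exec B (p ((g 0 x)[t])) (g t) (g (t + 1))) →
      Exec B (loop x p) (g 0) (g (g 0 x).length)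

/-- A bound on the running time of a program whose loops have at most `X` rounds. -/
noncomputable def cost : Prog V → Polynomial ℕ
  | skip => 1
  | push _ _ => 1
  | pop _ => 1
  | seq p q => cost p + cost q
  -- Adding the costs of all branches bounds whichever branch is taken.
  | case _ p => 1 + (cost (p none) + cost (p (some true)) + cost (p (some false)))
  -- Two copying passes, then one dispatch step and a body per round, then the exit step.
  | loop _ p => 2 * (Polynomial.X + 1) +
      (Polynomial.X * (1 + (cost (p true) + cost (p false))) + 1)

/-- The labels of the machine code of a program. -/
def Lab : Prog V → Type
  | skip => Unit
  | push _ _ => Unit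
  | pop _ => Unit
  | seq p q => Lab p ⊕ Lab q
  | case _ p => Unit ⊕ (Σ o, Lab (p o))
  | loop _ p => Fin 3 ⊕ (Σ b, Lab (p b))

noncomputable instance fintypeLab : ∀ p : Prog V, Fintype (Lab p)
  | skip => inferInstanceAs (Fintype Unit)
  | push _ _ => inferInstanceAs (Fintype Unit)
  | pop _ => inferInstanceAs (Fintype Unit)
  | seq p q => by
      have := fintypeLab p
      have := fintypeLab q
      exact inferInstanceAs (Fintype (Lab p ⊕ Lab q))
  | case _ p => by
      have := fun o => fintypeLab (p o)
      exact inferInstanceAs (Fintype (Unit ⊕ (Σ o, Lab (p o))))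
  | loop _ p => by
      have := fun b => fintypeLab (p b)
      exact inferInstanceAs (Fintype (Fin 3 ⊕ (Σ b, Lab (p b))))

/-- The label at which the machine code of a program starts. -/
def entry : ∀ p : Prog V, Lab p
  | skip => ()
  | push _ _ => ()
  | pop _ => ()
  | seq p _ => Sum.inl (entry p)
  | case _ _ => Sum.inl ()
  | loop _ _ => Sum.inl (0 : Fin 3)

open Turing
open TM2.Stmt (goto branch peek load halt)

/-- Machine statements with the stackMap `V`, one auxiliary stack for each label, and a buffer. -/
abbrev Code (V Λ : Type) : Type :=
  TM2.Stmt (fun _ : V ⊕ Option Λ => Bool) Λ (Option Bool)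

/-- The three statements of a loop: move `x` to the buffer, move the buffer back to `x` and to the
auxiliary stack `a`, consume the auxiliary stack. -/
def loopCode {Λ : Type} (x : V) (l : Fin 3 → Λ) (body : Bool → Λ) (exit : Λ) :
    Fin 3 → Code V Λ
  | 0 => TM2.Stmt.pop (Sum.inl x) (fun _ o => o) <| branch Option.isSome
      (TM2.Stmt.push (Sum.inr none) (fun o => o.getD false) <| goto fun _ => l 0) (goto fun _ => l 1)
  | 1 => TM2.Stmt.pop (Sum.inr none) (fun _ o => o) <| branch Option.isSome
      (TM2.Stmt.push (Sum.inl x) (fun o => o.getD false) <|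
        TM2.Stmt.push (Sum.inr (some (l 0))) (fun o => o.getD false) <| goto fun _ => l 1)
      (goto fun _ => l 2)
  | 2 => TM2.Stmt.pop (Sum.inr (some (l 0))) (fun _ o => o) <| branch Option.isSome
      (goto fun o => body (o.getD false)) (goto fun _ => exit)

/-- The machine code of a program whose labels are embedded into `Λ` by `e`; it continues at the
label `exit`. -/
def code {Λ : Type} : ∀ (p : Prog V) (_ : Lab p → Λ) (_ : Λ), Lab p → Code V Λ
  | skip, _, exit, _ => goto fun _ => exit
  | push x b, _, exit, _ => TM2.Stmt.push (Sum.inl x) (fun _ => b) (goto fun _ => exit)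
  | pop x, _, exit, _ => TM2.Stmt.pop (Sum.inl x) (fun v _ => v) (goto fun _ => exit)
  | seq p q, e, _, Sum.inl l => code p (fun l => e (Sum.inl l)) (e (Sum.inr (entry q))) l
  | seq _ q, e, exit, Sum.inr l => code q (fun l => e (Sum.inr l)) exit l
  | case x p, e, _, Sum.inl _ =>
      peek (Sum.inl x) (fun _ o => o) (goto fun o => e (Sum.inr ⟨o, entry (p o)⟩))
  | case _ p, e, exit, Sum.inr ⟨o, l⟩ => code (p o) (fun l => e (Sum.inr ⟨o, l⟩)) exit l
  | loop x p, e, exit, Sum.inl i =>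
      loopCode x (fun i => e (Sum.inl i)) (fun b => e (Sum.inr ⟨b, entry (p b)⟩)) exit i
  | loop _ p, e, _, Sum.inr ⟨b, l⟩ =>
      code (p b) (fun l => e (Sum.inr ⟨b, l⟩)) (e (Sum.inl (2 : Fin 3))) l

/-- The stackMap of the machine: the store `s`, the buffer `t`, the auxiliary stackMap `A`. -/
def stackMap {Λ : Type} (s : V → List Bool) (t : List Bool) (A : Λ → List Bool) :
    V ⊕ Option Λ → List Bool
  | Sum.inl x => s x
  | Sum.inr none => t
  | Sum.inr (some l) => A l

section stackMap

variable {Λ : Type} (s : V → List Bool) (t : List Bool) (A : Λ → List Bool) (w : List Bool)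

@[simp] lemma stackMap_inl (x : V) : stackMap s t A (Sum.inl x) = s x := rfl
@[simp] lemma stackMap_none : stackMap s t A (Sum.inr none) = t := rfl
@[simp] lemma stackMap_some (l : Λ) : stackMap s t A (Sum.inr (some l)) = A l := rfl

variable [DecidableEq V] [DecidableEq Λ]

@[simp] lemma update_stackMap_inl (x : V) :
    Function.update (stackMap s t A) (Sum.inl x) w = stackMap (Function.update s x w) t A := by
  funext k
  rcases k with y | _ | l <;> simp [stackMap, Function.update_apply]

@[simp] lemma update_stackMap_none :
    Function.update (stackMap s t A) (Sum.inr none) w = stackMap s w A := by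
  funext k
  rcases k with y | _ | l <;> simp [stackMap]

@[simp] lemma update_stackMap_some (l : Λ) :
    Function.update (stackMap s t A) (Sum.inr (some l)) w = stackMap s t (Function.update A l w) := by
  funext k
  rcases k with y | _ | l <;> simp [stackMap, Function.update_apply]

end stackMap

/-! ### Runs of a machine with a bound on the number of steps. -/

section RunsIn

variable {K Λ σ : Type} [DecidableEq K] {Γ : K → Type}

/-- The machine `M` gets from `c` to `c'` in at most `T` steps. -/
def RunsIn (M : Λ → TM2.Stmt Γ Λ σ) (T : ℕ) (c c' : TM2.Cfg Γ Λ σ) : Prop :=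
  ∃ n ≤ T, (flip bind (TM2.step M))^[n] (some c) = some c'

variable {M : Λ → TM2.Stmt Γ Λ σ} {T T' : ℕ} {c c' c'' : TM2.Cfg Γ Λ σ}

lemma RunsIn.trans (h : RunsIn M T c c') (h' : RunsIn M T' c' c'') : RunsIn M (T + T') c c'' := by
  obtain ⟨n, hn, h⟩ := h
  obtain ⟨m, hm, h'⟩ := h'
  exact ⟨m + n, by omega, by rw [Function.iterate_add_apply, h, h']⟩

lemma RunsIn.mono (h : RunsIn M T c c') (hT : T ≤ T') : RunsIn M T' c c' := by
  obtain ⟨n, hn, h⟩ := h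
  exact ⟨n, hn.trans hT, h⟩

lemma RunsIn.refl : RunsIn M T c c := ⟨0, by simp, rfl⟩

lemma RunsIn.of_step (h : TM2.step M c = some c') : RunsIn M 1 c c' := ⟨1, le_rfl, h⟩

lemma RunsIn.of_stmt {l : Λ} {q : TM2.Stmt Γ Λ σ} (hq : M l = q) (v : σ) (S : ∀ k, List (Γ k)) :
    RunsIn M 1 ⟨some l, v, S⟩ (TM2.stepAux q v S) :=
  RunsIn.of_step (by rw [TM2.step, hq])

end RunsIn

/-! ### Correctness of the loop code. -/

section loop

variable {Λ : Type} [DecidableEq V] [DecidableEq Λ] {M : Λ → Code V Λ} {x : V} {l : Fin 3 → Λ}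
  {body : Bool → Λ} {exit : Λ} (hM : ∀ i, M (l i) = loopCode x l body exit i)
include hM

lemma runsIn_loopCode_zero (A : Λ → List Bool) (w : List Bool) :
    ∀ (s : V → List Bool) (t : List Bool) (v : Option Bool), s x = w →
      ∃ v', RunsIn M (w.length + 1) ⟨some (l 0), v, stackMap s t A⟩
        ⟨some (l 1), v', stackMap (Function.update s x []) (w.reverse ++ t) A⟩ := by
  induction w with
  | nil =>
    intro s t v hs
    refine ⟨none, RunsIn.of_step ?_⟩
    simp [TM2.step, hM, loopCode, hs]
  | cons b w ih =>
    intro s t v hs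
    obtain ⟨v', h⟩ := ih (Function.update s x w) (b :: t) (some b) (by simp)
    refine ⟨v', ?_⟩
    have h0 : RunsIn M 1 ⟨some (l 0), v, stackMap s t A⟩
        ⟨some (l 0), some b, stackMap (Function.update s x w) (b :: t) A⟩ :=
      RunsIn.of_step (by simp [TM2.step, hM, loopCode, hs])
    have := h0.trans h
    simp only [Function.update_idem] at this
    simpa [add_comm, add_left_comm] using this

lemma runsIn_loopCode_one (w : List Bool) :
    ∀ (s : V → List Bool) (A : Λ → List Bool) (v : Option Bool),
      ∃ v', RunsIn M (w.length + 1) ⟨some (l 1), v, stackMap s w A⟩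
        ⟨some (l 2), v', stackMap (Function.update s x (w.reverse ++ s x)) []
          (Function.update A (l 0) (w.reverse ++ A (l 0)))⟩ := by
  induction w with
  | nil =>
    intro s A v
    refine ⟨none, RunsIn.of_step ?_⟩
    simp [TM2.step, hM, loopCode]
  | cons b w ih =>
    intro s A v
    obtain ⟨v', h⟩ := ih (Function.update s x (b :: s x))
      (Function.update A (l 0) (b :: A (l 0))) (some b)
    refine ⟨v', ?_⟩
    have h0 : RunsIn M 1 ⟨some (l 1), v, stackMap s (b :: w) A⟩
        ⟨some (l 1), some b, stackMap (Function.update s x (b :: s x)) w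
          (Function.update A (l 0) (b :: A (l 0)))⟩ :=
      RunsIn.of_step (by simp [TM2.step, hM, loopCode])
    have := h0.trans h
    simp only [Function.update_idem] at this
    simpa [add_comm, add_left_comm] using this

/-- Each pass reverses the order, so the second one restores `x` while leaving an equal copy on the
auxiliary stack. -/
lemma runsIn_loopCode_copy (s : V → List Bool) (A : Λ → List Bool) (hA : A (l 0) = [])
    (v : Option Bool) :
    ∃ v', RunsIn M (2 * ((s x).length + 1)) ⟨some (l 0), v, stackMap s [] A⟩
      ⟨some (l 2), v', stackMap s [] (Function.update A (l 0) (s x))⟩ := by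
  obtain ⟨v₁, h₁⟩ := runsIn_loopCode_zero hM A (s x) s [] v rfl
  obtain ⟨v₂, h₂⟩ := runsIn_loopCode_one hM (s x).reverse (Function.update s x []) A v₁
  refine ⟨v₂, ?_⟩
  rw [List.append_nil] at h₁
  have := h₁.trans h₂
  simp only [List.reverse_reverse, Function.update_self, List.append_nil, hA,
    Function.update_idem, Function.update_eq_self, List.length_reverse] at this
  exact this.mono (by omega)

lemma runsIn_loopCode_cons (s : V → List Bool) (A : Λ → List Bool) (b : Bool) (w : List Bool)
    (hA : A (l 0) = b :: w) (v : Option Bool) :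
    RunsIn M 1 ⟨some (l 2), v, stackMap s [] A⟩
      ⟨some (body b), some b, stackMap s [] (Function.update A (l 0) w)⟩ := by
  have := RunsIn.of_stmt (hM 2) v (stackMap s [] A)
  simpa only [loopCode, TM2.stepAux, stackMap_some, update_stackMap_some, hA, List.head?_cons,
    List.tail_cons, Option.isSome_some, cond_true, Option.getD_some] using this

lemma runsIn_loopCode_nil (s : V → List Bool) (A : Λ → List Bool) (hA : A (l 0) = [])
    (v : Option Bool) :
    RunsIn M 1 ⟨some (l 2), v, stackMap s [] A⟩ ⟨some exit, none, stackMap s [] A⟩ := by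
  have hu : Function.update A (l 0) [] = A := hA ▸ Function.update_eq_self _ _
  have := RunsIn.of_stmt (hM 2) v (stackMap s [] A)
  simpa only [loopCode, TM2.stepAux, stackMap_some, update_stackMap_some, hA, List.head?_nil,
    List.tail_nil, Option.isSome_none, cond_false, hu] using this

end loop

/-- The machine code of a program does what the program does. -/
theorem Exec.runsIn {Λ : Type} [DecidableEq V] [DecidableEq Λ] {M : Λ → Code V Λ} {B : ℕ}
    {p : Prog V} {s s' : V → List Bool} (h : Exec B p s s') :
    ∀ (e : Lab p → Λ) (exit : Λ) (_ : Function.Injective e)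
      (_ : ∀ l, M (e l) = code p e exit l) (A : Λ → List Bool) (_ : ∀ l, A (e l) = [])
      (v : Option Bool), ∃ v', RunsIn M (p.cost.eval B) ⟨some (e (entry p)), v, stackMap s [] A⟩
        ⟨some exit, v', stackMap s' [] A⟩ := by
  induction h with
  | skip s =>
    intro e exit _ hM A _ v
    exact ⟨v, (RunsIn.of_stmt (hM ()) _ _).mono (by simp [cost])⟩
  | push x b s =>
    intro e exit _ hM A _ v
    refine ⟨v, ?_⟩
    have := RunsIn.of_stmt (hM ()) v (stackMap s [] A)
    simp only [code, TM2.stepAux, stackMap_inl, update_stackMap_inl] at this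
    exact this.mono (by simp [cost])
  | pop x s =>
    intro e exit _ hM A _ v
    refine ⟨v, ?_⟩
    have := RunsIn.of_stmt (hM ()) v (stackMap s [] A)
    simp only [code, TM2.stepAux, stackMap_inl, update_stackMap_inl] at this
    exact this.mono (by simp [cost])
  | seq _ _ ihp ihq =>
    rename_i p q s₁ s₂ s₃ _ _
    intro e exit he hM A hA v
    obtain ⟨v₁, h₁⟩ := ihp (fun l => e (Sum.inl l)) (e (Sum.inr (entry q)))
      (he.comp Sum.inl_injective) (fun l => hM (Sum.inl l)) A (fun l => hA _) v
    obtain ⟨v₂, h₂⟩ := ihq (fun l => e (Sum.inr l)) exit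
      (he.comp Sum.inr_injective) (fun l => hM (Sum.inr l)) A (fun l => hA _) v₁
    refine ⟨v₂, (h₁.trans h₂).mono (by simp [cost])⟩
  | case _ ih =>
    rename_i x p s s' _
    intro e exit he hM A hA v
    obtain ⟨v₁, h₁⟩ := ih (fun l => e (Sum.inr ⟨_, l⟩)) exit
      (he.comp (Sum.inr_injective.comp sigma_mk_injective))
      (fun l => hM (Sum.inr ⟨_, l⟩)) A (fun l => hA _) (s x).head?
    have h0 := RunsIn.of_stmt (hM (Sum.inl ())) v (stackMap s [] A)
    simp only [code, TM2.stepAux, stackMap_inl] at h0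
    refine ⟨v₁, (h0.trans h₁).mono ?_⟩
    rcases (s x).head? with _ | _ | _ <;> simp [cost] <;> omega
  | loop g hB _ ih =>
    rename_i x p _
    intro e exit he hM A hA v
    have hM' : ∀ i, M (e (Sum.inl i)) = loopCode x (fun i => e (Sum.inl i))
        (fun b => e (Sum.inr ⟨b, entry (p b)⟩)) exit i := fun i => hM (Sum.inl i)
    obtain ⟨v₁, h₁⟩ := runsIn_loopCode_copy (l := fun i => e (Sum.inl i)) hM' (g 0) A (hA _) v
    set w := g 0 x with hw
    -- The rounds consume the auxiliary copy, so the body is free to change `x` itself.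
    have key : ∀ t, t ≤ w.length → ∃ v',
        RunsIn M (t * (1 + ((p true).cost.eval B + (p false).cost.eval B)))
          ⟨some (e (Sum.inl (2 : Fin 3))), v₁,
            stackMap (g 0) [] (Function.update A (e (Sum.inl (0 : Fin 3))) w)⟩
          ⟨some (e (Sum.inl (2 : Fin 3))), v',
            stackMap (g t) [] (Function.update A (e (Sum.inl (0 : Fin 3))) (w.drop t))⟩ := by
      intro t
      induction t with
      | zero => intro _; exact ⟨v₁, by simpa using RunsIn.refl⟩
      | succ t iht =>
        intro ht
        obtain ⟨v₂, h₂⟩ := iht (by omega)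
        obtain ⟨v₃, h₃⟩ := ih t (by omega) (fun l => e (Sum.inr ⟨_, l⟩)) (e (Sum.inl (2 : Fin 3)))
          (he.comp (Sum.inr_injective.comp sigma_mk_injective))
          (fun l => hM (Sum.inr ⟨_, l⟩))
          (Function.update A (e (Sum.inl (0 : Fin 3))) (w.drop (t + 1)))
          -- Injectivity of `e` separates the auxiliary stack of this loop from those of its body.
          (fun l => by
            rw [Function.update_of_ne (fun h => by simpa using he h)]
            exact hA _) (some w[t])
        have h0 := runsIn_loopCode_cons (l := fun i => e (Sum.inl i)) hM' (g t)
          (Function.update A (e (Sum.inl (0 : Fin 3))) (w.drop t)) w[t] (w.drop (t + 1))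
          (by rw [Function.update_self, List.drop_eq_getElem_cons]) v₂
        rw [Function.update_idem] at h0
        refine ⟨v₃, (h₂.trans (h0.trans h₃)).mono ?_⟩
        rw [Nat.succ_mul]
        rcases w[t] <;> simp
    obtain ⟨v₂, h₂⟩ := key _ le_rfl
    -- The auxiliary stack ends empty, so `A` is restored, as an enclosing loop requires of its
    -- body.
    have hu : Function.update A (e (Sum.inl (0 : Fin 3))) (w.drop w.length) = A := by
      rw [List.drop_length, ← hA (Sum.inl (0 : Fin 3))]
      exact Function.update_eq_self _ _
    rw [hu] at h₂
    have h₃ := runsIn_loopCode_nil (l := fun i => e (Sum.inl i)) hM' (g w.length) A (hA _) v₂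
    refine ⟨none, (h₁.trans (h₂.trans h₃)).mono ?_⟩
    simp only [cost, Polynomial.eval_add, Polynomial.eval_mul, Polynomial.eval_X,
      Polynomial.eval_one, Polynomial.eval_ofNat]
    gcongr

/-- The code of the Turing machine which runs the program `p` and then turns the stack `out`, which
is empty or has one entry, into an output bit. -/
def machineCode (p : Prog V) (out : V) : Option (Lab p) → Code V (Option (Lab p))
  | none => TM2.Stmt.pop (Sum.inl out) (fun _ o => o) <|
      TM2.Stmt.push (Sum.inl out) Option.isSome <| load (fun _ => none) halt
  | some l => code p some none l

/-- The Turing machine with the code `machineCode p out`. -/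
noncomputable def machine [DecidableEq V] [Fintype V] (p : Prog V) [DecidableEq (Lab p)]
    (inp out : V) : FinTM2 where
  K := V ⊕ Option (Option (Lab p))
  k₀ := Sum.inl inp
  k₁ := Sum.inl out
  Γ := fun _ => Bool
  Λ := Option (Lab p)
  main := some (entry p)
  σ := Option Bool
  initialState := none
  Γk₀Fin := inferInstanceAs (Fintype Bool)
  m := machineCode p out

lemma stackMap_update_nil {Λ : Type} [DecidableEq V] [DecidableEq Λ] (x : V) (w : List Bool)
    (k : V ⊕ Option Λ) : stackMap (Function.update (fun _ => []) x w) [] (fun _ => []) k =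
      if k = Sum.inl x then w else [] := by
  rcases k with y | _ | l <;> simp [stackMap, Function.update_apply]

lemma initList_machine [DecidableEq V] [Fintype V] (p : Prog V) [DecidableEq (Lab p)]
    (inp out : V) (w : List Bool) : initList (machine p inp out) w =
      (⟨some (some (entry p)), none,
        stackMap (Function.update (fun _ => []) inp w) [] (fun _ => [])⟩ :
        TM2.Cfg (fun _ : V ⊕ Option (Option (Lab p)) => Bool) _ (Option Bool)) := by
  refine congrArg (TM2.Cfg.mk _ _) (funext fun k => ?_)
  change V ⊕ Option (Option (Lab p)) at k
  refine Eq.trans ?_ (stackMap_update_nil _ _ k).symm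
  by_cases hk : k = Sum.inl inp
  · subst hk
    exact (dif_pos rfl).trans (if_pos rfl).symm
  · exact (dif_neg hk).trans (if_neg hk).symm

lemma haltList_machine [DecidableEq V] [Fintype V] (p : Prog V) [DecidableEq (Lab p)]
    (inp out : V) (w : List Bool) : haltList (machine p inp out) w =
      (⟨none, none, stackMap (Function.update (fun _ => []) out w) [] (fun _ => [])⟩ :
        TM2.Cfg (fun _ : V ⊕ Option (Option (Lab p)) => Bool) _ (Option Bool)) := by
  refine congrArg (TM2.Cfg.mk _ _) (funext fun k => ?_)
  change V ⊕ Option (Option (Lab p)) at k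
  refine Eq.trans ?_ (stackMap_update_nil _ _ k).symm
  by_cases hk : k = Sum.inl out
  · subst hk
    exact (dif_pos rfl).trans (if_pos rfl).symm
  · exact (dif_neg hk).trans (if_neg hk).symm

/-- A decision problem is in polynomial time if a program which clears its stackMap solves it and has
loops of polynomial length. -/
theorem computableInPolyTime [DecidableEq V] [Fintype V] {α : Type} (enc : α → List Bool)
    (f : α → Bool) (p : Prog V) (inp out : V) (Q : Polynomial ℕ)
    (h : ∀ a, Exec (Q.eval (enc a).length) p (Function.update (fun _ => []) inp (enc a))
      (Function.update (fun _ => []) out (if f a then [true] else []))) :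
    Nonempty (TM2ComputableInPolyTime enc Computability.encodeBool f) := by
  classical
  refine ⟨{ tm := machine p inp out
            inputAlphabet := Equiv.refl Bool
            outputAlphabet := Equiv.refl Bool
            time := p.cost.comp Q + 1
            outputsFun := fun a => Classical.choice ?_ }⟩
  obtain ⟨v, hv⟩ := (h a).runsIn (M := machineCode p out) some none
    (Option.some_injective _) (fun l => rfl) (fun _ => []) (fun _ => rfl) none
  -- The last statement turns an empty or one-entry stack into one bit and resets the internal
  -- state, which a halting configuration must have at its initial value.
  have h1 : RunsIn (machineCode p out) 1
      ⟨some none, v, stackMap (Function.update (fun _ => []) out (if f a then [true] else [])) []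
        (fun _ => [])⟩
      ⟨none, none, stackMap (Function.update (fun _ => []) out [f a]) [] (fun _ => [])⟩ := by
    have hq : machineCode p out none = TM2.Stmt.pop (Sum.inl out) (fun _ o => o)
      (TM2.Stmt.push (Sum.inl out) Option.isSome <| load (fun _ => none) halt) := rfl
    have := RunsIn.of_stmt hq v
      (stackMap (Function.update (fun _ => []) out (if f a then [true] else [])) [] (fun _ => []))
    simp only [TM2.stepAux, stackMap_inl, update_stackMap_inl, Function.update_self,
      Function.update_idem] at this
    cases hf : f a <;> simpa [hf] using this
  obtain ⟨n, hn, h3⟩ := hv.trans h1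
  have hmap : ∀ w : List Bool, List.map (Equiv.refl Bool).invFun w = w := List.map_id
  refine ⟨⟨⟨n, ?_⟩, ?_⟩⟩
  · have hi := (congrArg (initList (machine p inp out)) (hmap (enc a))).trans
      (initList_machine p inp out (enc a))
    have ho := (congrArg (haltList (machine p inp out)) (hmap [f a])).trans
      (haltList_machine p inp out [f a])
    exact (congrArg (fun c => (flip bind (TM2.step (machineCode p out)))^[n] (some c)) hi).trans
      (h3.trans (congrArg some ho.symm))
  · simpa [Polynomial.eval_comp] using hn

end Prog

end MajThrNat

namespace MajThrNat

/-! ### The program deciding Nisan's property -/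

namespace Prog

/-! ### Derived commands and their execution rules. -/

section rules

variable {V : Type} [DecidableEq V] {B : ℕ}

/-- Repeat a program once for each entry of a stack. -/
def rep (x : V) (p : Prog V) : Prog V := loop x fun _ => p

/-- Make a stack empty. -/
def clr (x : V) : Prog V := rep x (pop x)

/-- Push `m` entries to a stack. -/
def pushMany (x : V) : ℕ → Prog V
  | 0 => skip
  | m + 1 => seq (push x true) (pushMany x m)

/-- Repeat a program `n ^ m` times, where `n` is the number of entries of a stack. -/
def nest (x : V) : ℕ → Prog V → Prog V
  | 0, p => p
  | m + 1, p => rep x (nest x m p)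

/-- Repeat a program once for each entry of the stack `x`, with `y` as a counter. -/
def count (y x : V) (p : Prog V) : Prog V := seq (rep x (seq p (push y true))) (clr y)

variable {x y : V} {p : Prog V} {s s' : V → List Bool}

lemma Exec.push_eq {b : Bool} (h : s' = Function.update s x (b :: s x)) :
    Exec B (Prog.push x b) s s' := h ▸ Exec.push x b s

lemma Exec.pop_eq (h : s' = Function.update s x (s x).tail) : Exec B (Prog.pop x) s s' :=
  h ▸ Exec.pop x s

lemma Exec.loop_eq {p : Bool → Prog V} (g : ℕ → V → List Bool) (w : List Bool) (h0 : g 0 = s)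
    (hw : s x = w) (hn : g w.length = s') (hB : w.length ≤ B)
    (hg : ∀ t (h : t < w.length), Exec B (p w[t]) (g t) (g (t + 1))) :
    Exec B (Prog.loop x p) s s' := by
  subst h0 hw hn
  exact Exec.loop g hB hg

lemma Exec.rep (g : ℕ → V → List Bool) (n : ℕ) (h0 : g 0 = s) (hs : (s x).length = n)
    (hn : g n = s') (hB : n ≤ B) (hg : ∀ t < n, Exec B p (g t) (g (t + 1))) :
    Exec B (rep x p) s s' :=
  Exec.loop_eq g (s x) h0 rfl (hs ▸ hn) (hs ▸ hB) fun t h => hg t (hs ▸ h)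

lemma Exec.clr (hB : (s x).length ≤ B) (h : s' = Function.update s x []) :
    Exec B (clr x) s s' := by
  refine Exec.rep (fun t => Function.update s x ((s x).drop t)) _ (by simp) rfl (by simp [h]) hB
    fun t ht => Exec.pop_eq ?_
  simp

lemma Exec.case_eq {p : Option Bool → Prog V} (o : Option Bool) (ho : (s x).head? = o)
    (h : Exec B (p o) s s') : Exec B (Prog.case x p) s s' := Exec.case (ho ▸ h)

lemma Exec.pushMany (m : ℕ) : ∀ {s s' : V → List Bool},
    s' = Function.update s x (List.replicate m true ++ s x) → Exec B (pushMany x m) s s' := by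
  induction m with
  | zero =>
    rintro s s' rfl
    simpa [Prog.pushMany] using Exec.skip (B := B) s
  | succ m ih =>
    rintro s s' rfl
    refine Exec.seq (Exec.push x true s) (ih ?_)
    simp [List.replicate_succ']

/-- One sequence of stores `g`, advanced once per execution of `p`, describes all nesting levels at
the same time. -/
lemma Exec.nest (g : ℕ → V → List Bool) (n : ℕ) (hB : n ≤ B) (hx : ∀ t, (g t x).length = n)
    (hp : ∀ t, Exec B p (g t) (g (t + 1))) (m : ℕ) :
    ∀ a, Exec B (nest x m p) (g a) (g (a + n ^ m)) := by
  induction m with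
  | zero => exact fun a => by simpa [Prog.nest] using hp a
  | succ m ih =>
    intro a
    refine Exec.rep (fun t => g (a + t * n ^ m)) n (by simp) (hx a) (by ring_nf) hB fun t ht => ?_
    have := ih (a + t * n ^ m)
    rwa [add_assoc, ← Nat.succ_mul] at this

/-- In `g t z` the counter is t and the accumulator z. As the counter is reset at the end, the
conclusion has the shape of the hypothesis `hp`, so the rule can be nested. -/
lemma Exec.count {g : ℕ → ℕ → V → List Bool} (f : ℕ → ℕ) (n : ℕ) (hB : n ≤ B)
    (hx : ∀ z, (g 0 z x).length = n) (hy : ∀ t z, (g t z y).length = t)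
    (hs : ∀ t z, g (t + 1) z = Function.update (g t z) y (true :: g t z y))
    (hc : ∀ t z, g 0 z = Function.update (g t z) y [])
    (hp : ∀ t < n, ∀ z, Exec B p (g t z) (g t (z + f t))) (z : ℕ) :
    Exec B (count y x p) (g 0 z) (g 0 (z + ∑ t ∈ Finset.range n, f t)) := by
  refine Exec.seq (s₂ := g n (z + ∑ t ∈ Finset.range n, f t)) ?_ (Exec.clr ?_ ?_)
  · refine Exec.rep (fun t => g t (z + ∑ t ∈ Finset.range t, f t)) n (by simp) (hx _) rfl hB ?_
    intro t ht
    refine Exec.seq (hp t ht _) (Exec.push_eq ?_)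
    rw [Finset.sum_range_succ, ← add_assoc, hs]
  · rw [hy]; exact hB
  · exact hc _ _

end rules

/-- The stacks of the program. -/
inductive Reg
  | W | Wr | V | N | C | R | i | i' | k | k' | P | S | X | F | O
  deriving DecidableEq

instance : Fintype Reg :=
  ⟨{.W, .Wr, .V, .N, .C, .R, .i, .i', .k, .k', .P, .S, .X, .F, .O}, fun x => by
    cases x <;> decide⟩

/-- The contents of the stacks of the program, most of which are unary counters. -/
structure Regs where
  W : List Bool := []
  Wr : List Bool := []
  V : List Bool := []
  N : ℕ := 0
  C : ℕ := 0
  R : ℕ := 0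
  i : ℕ := 0
  i' : ℕ := 0
  k : ℕ := 0
  k' : ℕ := 0
  P : Bool := false
  S : ℕ := 0
  X : ℕ := 0
  F : ℕ := 0
  O : Bool := false

/-- A store of the program. -/
def Regs.store (r : Regs) : Reg → List Bool
  | .W => r.W
  | .Wr => r.Wr
  | .V => r.V
  | .N => List.replicate r.N true
  | .C => List.replicate r.C true
  | .R => List.replicate r.R true
  | .i => List.replicate r.i true
  | .i' => List.replicate r.i' true
  | .k => List.replicate r.k true
  | .k' => List.replicate r.k' true
  | .P => bif r.P then [true] else []
  | .S => List.replicate r.S true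
  | .X => List.replicate r.X true
  | .F => List.replicate r.F true
  | .O => bif r.O then [true] else []

infixr:60 " ⨾ " => Prog.seq

open Reg

/-- Copy the input and compute its length. -/
def readInput : Prog Reg := loop W fun b => push Wr b ⨾ push N true

/-- Double `C` if `4 * C ^ 2 ≤ N`. -/
def doubleStep : Prog Reg :=
  rep C (rep C (pushMany F 4)) ⨾ rep N (pop F) ⨾
    case F fun o => if o = none then rep C (push C true) else clr F

/-- Compute `C` and `R` with `C * R = N` and `R = C` or `R = 2 * C` -/
def dimensions : Prog Reg :=
  push C true ⨾ rep N doubleStep ⨾ rep C (push R true) ⨾ rep N (push F true) ⨾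
    rep C (rep C (pop F)) ⨾
    case F fun o => if o = none then skip else rep C (push R true) ⨾ clr F

/-- Add the bit in row `x` and column `y` to the parity `P`. -/
def addBit (x y : Reg) : Prog Reg :=
  loop Wr (fun b => push V b) ⨾ rep x (rep C (pop V)) ⨾ rep y (pop V) ⨾
    case V (fun o => if o = some true then
      case P (fun o => if o = none then push P true else pop P) else skip) ⨾ clr V

/-- Add `2` to `S` if the parity of the four bits in rows `i`, `i'` and columns `k`, `k'` is even. -/
def addQuad : Prog Reg :=
  addBit i k ⨾ addBit i k' ⨾ addBit i' k ⨾ addBit i' k' ⨾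
    case P fun o => if o = none then push S true ⨾ push S true else pop P

/-- Compute in `S` the sum of all products of signs. -/
def boxes : Prog Reg :=
  count i R (count i' R (count k C (count k' C addQuad))) ⨾ nest N 2 (pop S)

/-- Compute whether `S ^ 3 ≤ N ^ 5` or `N < M`. -/
def compare (M : ℕ) : Prog Reg :=
  nest S 3 (push X true) ⨾
    nest N 5 (pop X) ⨾
    pushMany F M ⨾ rep N (pop F) ⨾
    case F (fun o => if o = none then skip else clr X ⨾ clr F) ⨾
    case X (fun o => if o = none then push O true else clr X)

/-- Clear the stacks. -/
def cleanUp : Prog Reg := clr W ⨾ clr Wr ⨾ clr N ⨾ clr C ⨾ clr R ⨾ clr S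

/-- The program deciding Nisan's property for inputs of length at least `M`. -/
def nisanProg (M : ℕ) : Prog Reg :=
  readInput ⨾ dimensions ⨾ boxes ⨾ compare M ⨾ cleanUp

/-! ### Correctness of reading the input, finding the dimensions and looking up bits. -/

variable {B : ℕ}

lemma reverse_take_succ (w : List Bool) {t : ℕ} (ht : t < w.length) :
    (w.take (t + 1)).reverse = w[t] :: (w.take t).reverse := by
  rw [List.take_add_one, List.getElem?_eq_getElem ht]
  simp

lemma exec_readInput (w : List Bool) (hB : w.length ≤ B) :
    Exec B readInput (Regs.store {W := w})
      (Regs.store {W := w, Wr := w.reverse, N := w.length}) := by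
  refine Exec.loop_eq (fun t => Regs.store {W := w, Wr := (w.take t).reverse, N := t}) w
    (by simp) rfl (by simp) hB fun t ht => Exec.seq
      (s₂ := Regs.store {W := w, Wr := (w.take (t + 1)).reverse, N := t})
      (Exec.push_eq ?_) (Exec.push_eq ?_)
  · funext v; cases v <;> simp [Regs.store, reverse_take_succ _ ht]
  · funext v; cases v <;> simp [Regs.store, List.replicate_succ]

lemma exec_rep_pop_F (r : Regs) (x : Reg) (hB : (r.store x).length ≤ B) :
    Exec B (rep x (pop F)) r.store ({r with F := r.F - (r.store x).length} : Regs).store := by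
  refine Exec.rep (fun t => ({r with F := r.F - t} : Regs).store) _ (by simp) rfl rfl hB
    fun t ht => Exec.pop_eq ?_
  funext v; cases v <;> simp [Regs.store, Nat.sub_sub]

lemma exec_doubleStep {n j : ℕ} (hj : j ≤ n / 2) (r : Regs) (hB : 4 * (2 ^ n * 2 ^ n) ≤ B) :
    Exec B doubleStep ({r with N := 2 ^ n, C := 2 ^ j, F := 0} : Regs).store
      ({r with N := 2 ^ n, C := 2 ^ min (j + 1) (n / 2), F := 0} : Regs).store := by
  have hn : 2 ^ n * 1 ≤ 2 ^ n * 2 ^ n := Nat.mul_le_mul_left _ Nat.one_le_two_pow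
  have hCn : (2 : ℕ) ^ j ≤ 2 ^ n := Nat.pow_le_pow_right (by norm_num) (by omega)
  have hCC : (2 : ℕ) ^ j * 2 ^ j ≤ 2 ^ n * 2 ^ n := Nat.mul_le_mul hCn hCn
  have h4 : (2 : ℕ) ^ j * (2 ^ j * 4) = 2 ^ (2 * j + 2) := by ring
  have h1 : Exec B (rep C (rep C (pushMany F 4)))
      ({r with N := 2 ^ n, C := 2 ^ j, F := 0} : Regs).store
      ({r with N := 2 ^ n, C := 2 ^ j, F := 2 ^ j * (2 ^ j * 4)} : Regs).store := by
    refine Exec.rep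
      (fun t => ({r with N := 2 ^ n, C := 2 ^ j, F := t * (2 ^ j * 4)} : Regs).store) (2 ^ j)
      (by simp) (by simp [Regs.store]) rfl (by omega) fun t ht => ?_
    refine Exec.rep
      (fun u => ({r with N := 2 ^ n, C := 2 ^ j, F := t * (2 ^ j * 4) + u * 4} : Regs).store)
      (2 ^ j) (by simp) (by simp [Regs.store]) ?_ (by omega) fun u hu => Exec.pushMany 4 ?_
    · congr 2; ring
    · funext v; cases v <;> simp [Regs.store, List.replicate_succ, add_mul, ← add_assoc]
  have h2 := exec_rep_pop_F (B := B)
    ({r with N := 2 ^ n, C := 2 ^ j, F := 2 ^ j * (2 ^ j * 4)} : Regs) Reg.N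
    (by simp [Regs.store]; omega)
  refine Exec.seq h1 (Exec.seq h2 ?_)
  simp only [Regs.store, List.length_replicate, h4]
  -- `F` now holds the truncated difference 4 C² - N, which is empty exactly when C can still be
  -- doubled.
  by_cases h : j + 1 ≤ n / 2
  · have h0 : 2 ^ (2 * j + 2) - 2 ^ n = 0 :=
      Nat.sub_eq_zero_of_le (Nat.pow_le_pow_right (by norm_num) (by omega))
    rw [h0, min_eq_left h]
    refine Exec.case_eq none (by simp [Regs.store]) ?_
    rw [if_pos rfl]
    refine Exec.rep (fun t => ({r with N := 2 ^ n, C := 2 ^ j + t, F := 0} : Regs).store) (2 ^ j)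
      (by simp) (by simp [Regs.store]) ?_ (by omega) fun t ht => Exec.push_eq ?_
    · congr 2; ring
    · funext v; cases v <;> simp [Regs.store, List.replicate_succ, ← add_assoc]
  · have hj' : j = n / 2 := by omega
    obtain ⟨d, hd⟩ : ∃ d, 2 ^ (2 * j + 2) - 2 ^ n = d + 1 :=
      Nat.exists_eq_add_one.2 (Nat.sub_pos_of_lt (Nat.pow_lt_pow_right (by norm_num) (by omega)))
    rw [hd, min_eq_right (by omega), ← hj']
    refine Exec.case_eq (some true) (by simp [Regs.store, List.replicate_succ]) ?_
    rw [if_neg (by simp)]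
    refine Exec.clr ?_ ?_
    · have : 2 ^ (2 * j + 2) ≤ B := by rw [← h4]; linarith
      simp [Regs.store]; omega
    · funext v; cases v <;> simp [Regs.store]

lemma exec_dimensions {n : ℕ} (r : Regs) (hB : 4 * (2 ^ n * 2 ^ n) ≤ B) :
    Exec B dimensions ({r with N := 2 ^ n, C := 0, R := 0, F := 0} : Regs).store
      ({r with N := 2 ^ n, C := 2 ^ (n / 2), R := 2 ^ ((n + 1) / 2), F := 0} : Regs).store := by
  have hn : 2 ^ n * 1 ≤ 2 ^ n * 2 ^ n := Nat.mul_le_mul_left _ Nat.one_le_two_pow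
  have hCn : (2 : ℕ) ^ (n / 2) ≤ 2 ^ n := Nat.pow_le_pow_right (by norm_num) (by omega)
  have hCC : (2 : ℕ) ^ (n / 2) * 2 ^ (n / 2) = 2 ^ (2 * (n / 2)) := by ring
  set D := 2 ^ (n / 2) with hD
  refine Exec.seq (s₂ := ({r with N := 2 ^ n, C := 1, R := 0, F := 0} : Regs).store)
    (Exec.push_eq ?_) (Exec.seq
    (s₂ := ({r with N := 2 ^ n, C := D, R := 0, F := 0} : Regs).store) ?_ (Exec.seq
    (s₂ := ({r with N := 2 ^ n, C := D, R := D, F := 0} : Regs).store) ?_ (Exec.seq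
    (s₂ := ({r with N := 2 ^ n, C := D, R := D, F := 2 ^ n} : Regs).store) ?_ (Exec.seq
    (s₂ := ({r with N := 2 ^ n, C := D, R := D, F := 2 ^ n - D * D} : Regs).store) ?_ ?_))))
  · funext v; cases v <;> simp [Regs.store]
  · refine Exec.rep
      (fun t => ({r with N := 2 ^ n, C := 2 ^ min t (n / 2), R := 0, F := 0} : Regs).store)
      (2 ^ n) (by simp) (by simp [Regs.store]) ?_ (by omega) fun t ht => ?_
    · have : n < 2 ^ n := Nat.lt_two_pow_self
      -- There are N = 2^n rounds, more than the n / 2 doublings needed; the surplus rounds change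
      -- nothing.
      rw [min_eq_right (by omega)]
    · have := exec_doubleStep (B := B) (n := n) (j := min t (n / 2)) (by omega)
        ({r with R := 0} : Regs) hB
      have hm : min (min t (n / 2) + 1) (n / 2) = min (t + 1) (n / 2) := by omega
      rwa [hm] at this
  · refine Exec.rep (fun t => ({r with N := 2 ^ n, C := D, R := t, F := 0} : Regs).store) D
      (by simp) (by simp [Regs.store]) rfl (by omega) fun t ht => Exec.push_eq ?_
    funext v; cases v <;> simp [Regs.store, List.replicate_succ]
  · refine Exec.rep (fun t => ({r with N := 2 ^ n, C := D, R := D, F := t} : Regs).store) (2 ^ n)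
      (by simp) (by simp [Regs.store]) rfl (by omega) fun t ht => Exec.push_eq ?_
    funext v; cases v <;> simp [Regs.store, List.replicate_succ]
  · refine Exec.rep
      (fun t => ({r with N := 2 ^ n, C := D, R := D, F := 2 ^ n - t * D} : Regs).store) D (by simp)
      (by simp [Regs.store]) rfl (by omega) fun t ht => ?_
    have := exec_rep_pop_F (B := B)
      ({r with N := 2 ^ n, C := D, R := D, F := 2 ^ n - t * D} : Regs) Reg.C
      (by simp [Regs.store]; omega)
    simpa [Regs.store, Nat.sub_sub, add_mul] using this
  · rw [hCC]
    -- N - C² vanishes exactly for even n; for odd n there are twice as many rows as columns.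
    rcases Nat.even_or_odd' n with ⟨m, rfl | rfl⟩
    · rw [hD, show 2 * m / 2 = m by omega, show (2 * m + 1) / 2 = m by omega, Nat.sub_self]
      refine Exec.case_eq none (by simp [Regs.store]) ?_
      rw [if_pos rfl]
      exact Exec.skip _
    · rw [hD, show (2 * m + 1) / 2 = m by omega, show (2 * m + 1 + 1) / 2 = m + 1 by omega,
        show 2 ^ (2 * m + 1) - 2 ^ (2 * m) = 2 ^ (2 * m) by rw [pow_succ]; omega]
      rw [show (2 * m + 1) / 2 = m by omega] at hD
      rw [hD] at hCn
      obtain ⟨d, hd⟩ : ∃ d, 2 ^ (2 * m) = d + 1 := Nat.exists_eq_add_one.2 (by positivity)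
      refine Exec.case_eq (some true) (by simp [Regs.store, hd, List.replicate_succ]) ?_
      rw [if_neg (by simp)]
      refine Exec.seq (s₂ := ({r with N := 2 ^ (2 * m + 1), C := 2 ^ m, R := 2 ^ (m + 1),
                                      F := 2 ^ (2 * m)} : Regs).store) ?_ (Exec.clr ?_ ?_)
      · refine Exec.rep (fun t => ({r with N := 2 ^ (2 * m + 1), C := 2 ^ m, R := 2 ^ m + t,
                                           F := 2 ^ (2 * m)} : Regs).store) (2 ^ m)
          (by simp) (by simp [Regs.store]) ?_ (by omega) fun t ht => Exec.push_eq ?_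
        · congr 2; ring
        · funext v; cases v <;> simp [Regs.store, List.replicate_succ, ← add_assoc]
      · have : 2 ^ (2 * m + 1) = 2 * 2 ^ (2 * m) := by ring
        simp only [Regs.store, List.length_replicate]
        omega
      · funext v; cases v <;> simp [Regs.store]

/-- The bit in row `a` and column `b` of the table with the reversed entries `Wr`. -/
def Regs.bit (r : Regs) (a b : ℕ) : Bool := r.Wr.reverse.getD (a * r.C + b) false

lemma Regs.store_V (r : Regs) (l : List Bool) :
    ({r with V := l} : Regs).store = Function.update r.store Reg.V l := by
  funext v; cases v <;> simp [Regs.store]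

/-- Pushing the reversed input onto `V` restores its order, and after a C + b pops the wanted entry
is on top. A nonempty `P` means odd parity. -/
lemma exec_addBit (r : Regs) (x y : Reg) (hx : x ≠ V) (hy : y ≠ V) 
    (hxB : (r.store x).length ≤ B) (hyB : (r.store y).length ≤ B) (hCB : r.C ≤ B)
    (hWB : r.Wr.length ≤ B) :
    Exec B (addBit x y) ({r with V := []} : Regs).store
      ({r with V := [], P := r.P ^^ r.bit (r.store x).length (r.store y).length} : Regs).store := by
  have hst : ∀ l z, z ≠ Reg.V → ({r with V := l} : Regs).store z = r.store z := by
    intro l z hz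
    rw [Regs.store_V, Function.update_of_ne hz]
  set a := (r.store x).length with ha
  set b := (r.store y).length with hb
  set w := r.Wr.reverse with hw
  have hwl : w.length ≤ B := by simpa [hw] using hWB
  refine Exec.seq (s₂ := ({r with V := w} : Regs).store) ?_ (Exec.seq
    (s₂ := ({r with V := w.drop (a * r.C)} : Regs).store) ?_ (Exec.seq
    (s₂ := ({r with V := w.drop (a * r.C + b)} : Regs).store) ?_ (Exec.seq
    (s₂ := ({r with V := w.drop (a * r.C + b), P := r.P ^^ r.bit a b} : Regs).store) ?_ ?_)))
  · refine Exec.loop_eq (fun t => ({r with V := (r.Wr.take t).reverse} : Regs).store) r.Wr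
      (by simp) rfl (by simp [hw]) hWB fun t ht => Exec.push_eq ?_
    funext v; cases v <;> simp [Regs.store, reverse_take_succ _ ht]
  · refine Exec.rep (fun t => ({r with V := w.drop (t * r.C)} : Regs).store) a (by simp)
      (by rw [hst _ _ hx]) rfl hxB fun t ht => ?_
    refine Exec.rep (fun u => ({r with V := w.drop (t * r.C + u)} : Regs).store) r.C (by simp)
      (by simp [Regs.store]) (by simp [add_mul]) hCB fun u hu => Exec.pop_eq ?_
    funext v; cases v <;> simp [Regs.store, ← add_assoc]
  · refine Exec.rep (fun u => ({r with V := w.drop (a * r.C + u)} : Regs).store) b (by simp)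
      (by rw [hst _ _ hy]) rfl hyB fun u hu => Exec.pop_eq ?_
    funext v; cases v <;> simp [Regs.store, ← add_assoc]
  · have hbit : r.bit a b = ((w.drop (a * r.C + b)).head?.getD false) := by
      simp [Regs.bit, ← hw]
    refine Exec.case_eq (w.drop (a * r.C + b)).head? (by simp [Regs.store]) ?_
    -- An exhausted table leaves `P` unchanged, in agreement with the default `false` of `getD`.
    rcases ho : (w.drop (a * r.C + b)).head? with _ | _ | _
    · rw [if_neg (by simp), hbit, ho]
      simpa using Exec.skip _
    · rw [if_neg (by simp), hbit, ho]
      simpa using Exec.skip _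
    · rw [if_pos rfl, hbit, ho]
      cases r.P
      · refine Exec.case_eq none (by simp [Regs.store]) ?_
        rw [if_pos rfl]
        refine Exec.push_eq ?_
        funext v; cases v <;> simp [Regs.store]
      · refine Exec.case_eq (some true) (by simp [Regs.store]) ?_
        rw [if_neg (by simp)]
        refine Exec.pop_eq ?_
        funext v; cases v <;> simp [Regs.store]
  · refine Exec.clr ?_ ?_
    · simp [Regs.store]; omega
    · funext v; cases v <;> simp [Regs.store]

/-- The parity of the four bits in rows `a`, `a'` and columns `b`, `b'`. -/
def Regs.parity (r : Regs) (a a' b b' : ℕ) : Bool :=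
  r.bit a b ^^ r.bit a b' ^^ r.bit a' b ^^ r.bit a' b'

lemma exec_addQuad (r : Regs) (hi : r.i ≤ B) (hi' : r.i' ≤ B) (hk : r.k ≤ B) (hk' : r.k' ≤ B)
    (hCB : r.C ≤ B) (hWB : r.Wr.length ≤ B) :
    Exec B addQuad ({r with V := [], P := false} : Regs).store
      ({r with V := [], P := false,
               S := r.S + if r.parity r.i r.i' r.k r.k' then 0 else 2} : Regs).store := by
  have h (b : Bool) (x y : Reg) (hx : x = i ∨ x = i') (hy : y = k ∨ y = k') :=
    exec_addBit (B := B) {r with P := b} x y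
      (by rcases hx with rfl | rfl <;> simp) (by rcases hy with rfl | rfl <;> simp)
      (by rcases hx with rfl | rfl <;> simpa [Regs.store])
      (by rcases hy with rfl | rfl <;> simpa [Regs.store]) hCB hWB
  have h1 := h false i k (by simp) (by simp)
  have h2 := h (r.bit r.i r.k) i k' (by simp) (by simp)
  have h3 := h (r.bit r.i r.k ^^ r.bit r.i r.k') i' k (by simp) (by simp)
  have h4 := h (r.bit r.i r.k ^^ r.bit r.i r.k' ^^ r.bit r.i' r.k) i' k' (by simp) (by simp)
  have hb : ∀ c a b, Regs.bit {r with P := c} a b = r.bit a b := fun _ _ _ => rfl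
  simp only [Regs.store, List.length_replicate, hb, Bool.false_xor, Bool.xor_assoc]
    at h1 h2 h3 h4
  refine Exec.seq h1 (Exec.seq h2 (Exec.seq h3 (Exec.seq h4 ?_)))
  have hpar : (r.bit r.i r.k ^^ (r.bit r.i r.k' ^^ (r.bit r.i' r.k ^^ r.bit r.i' r.k'))) =
      r.parity r.i r.i' r.k r.k' := by simp only [Regs.parity, Bool.xor_assoc]
  rw [hpar]
  cases r.parity r.i r.i' r.k r.k'
  · refine Exec.case_eq none (by simp [Regs.store]) ?_
    rw [if_pos rfl]
    refine Exec.seq (s₂ := ({r with V := [], P := false, S := r.S + 1} : Regs).store)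
      (Exec.push_eq ?_) (Exec.push_eq ?_) <;>
    · funext v; cases v <;> simp [Regs.store, List.replicate_succ]
  · refine Exec.case_eq (some true) (by simp [Regs.store]) ?_
    rw [if_neg (by simp)]
    refine Exec.pop_eq ?_
    funext v; cases v <;> simp [Regs.store]

end Prog

end MajThrNat

/-! ### Correctness of the box count, the comparison and the whole program. -/

namespace MajThrNat

namespace Prog

open Reg

variable {B : ℕ}

/-- Twice the number of combinatorial rectangles with an even number of ones in a table with `R`
rows and `C` columns, where `w` lists the entries row by row. -/
def evenBoxes (w : List Bool) (R C : ℕ) : ℕ :=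
  ∑ a ∈ Finset.range R, ∑ a' ∈ Finset.range R, ∑ b ∈ Finset.range C, ∑ b' ∈ Finset.range C,
    if (w.getD (a * C + b) false ^^ w.getD (a * C + b') false ^^
      w.getD (a' * C + b) false ^^ w.getD (a' * C + b') false) then 0 else 2

lemma evenBoxes_le (w : List Bool) (R C : ℕ) : evenBoxes w R C ≤ 2 * ((R * C) * (R * C)) := by
  calc evenBoxes w R C ≤ ∑ a ∈ Finset.range R, ∑ a' ∈ Finset.range R, ∑ b ∈ Finset.range C,
        ∑ b' ∈ Finset.range C, 2 := by
        unfold evenBoxes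
        gcongr
        split <;> simp
    _ = _ := by simp; ring

/-- The registers while the boxes are counted. -/
def Regs.atBox (r : Regs) (a a' b b' z : ℕ) : Regs :=
  {r with V := [], P := false, i := a, i' := a', k := b, k' := b', S := z}

lemma exec_boxes (r : Regs) (hC : r.C ≤ B) (hR : r.R ≤ B) (hN : r.N ≤ B)
    (hW : r.Wr.length ≤ B) :
    Exec B boxes (r.atBox 0 0 0 0 0).store
      (r.atBox 0 0 0 0 (evenBoxes r.Wr.reverse r.R r.C - r.N ^ 2)).store := by
  refine Exec.seq (s₂ := (r.atBox 0 0 0 0 (0 + evenBoxes r.Wr.reverse r.R r.C)).store) ?_ ?_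
  · refine Exec.count (g := fun t z => (r.atBox t 0 0 0 z).store) _ r.R hR
      (by simp [Regs.store, Regs.atBox]) (by simp [Regs.store, Regs.atBox])
      (fun t z => ?_) (fun t z => ?_) (fun a ha z => ?_) 0
    iterate 2 funext v; cases v <;> simp [Regs.store, Regs.atBox, List.replicate_succ]
    refine Exec.count (g := fun t z => (r.atBox a t 0 0 z).store) _ r.R hR
      (by simp [Regs.store, Regs.atBox]) (by simp [Regs.store, Regs.atBox])
      (fun t z => ?_) (fun t z => ?_) (fun a' ha' z => ?_) z
    iterate 2 funext v; cases v <;> simp [Regs.store, Regs.atBox, List.replicate_succ]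
    refine Exec.count (g := fun t z => (r.atBox a a' t 0 z).store) _ r.C hC
      (by simp [Regs.store, Regs.atBox]) (by simp [Regs.store, Regs.atBox])
      (fun t z => ?_) (fun t z => ?_) (fun b hb z => ?_) z
    iterate 2 funext v; cases v <;> simp [Regs.store, Regs.atBox, List.replicate_succ]
    refine Exec.count (g := fun t z => (r.atBox a a' b t z).store) _ r.C hC
      (by simp [Regs.store, Regs.atBox]) (by simp [Regs.store, Regs.atBox])
      (fun t z => ?_) (fun t z => ?_) (fun b' hb' z => ?_) z
    iterate 2 funext v; cases v <;> simp [Regs.store, Regs.atBox, List.replicate_succ]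
    exact exec_addQuad (r.atBox a a' b b' z) (by simp [Regs.atBox]; omega)
      (by simp [Regs.atBox]; omega) (by simp [Regs.atBox]; omega) (by simp [Regs.atBox]; omega)
      hC hW
  · have := Exec.nest (B := B) (x := N) (p := pop S)
      (fun t => (r.atBox 0 0 0 0 (evenBoxes r.Wr.reverse r.R r.C - t)).store) r.N hN
      (by simp [Regs.store, Regs.atBox])
      (fun t => Exec.pop_eq
        (by funext v; cases v <;> simp [Regs.store, Regs.atBox, Nat.sub_sub])) 2 0
    simpa using this

lemma exec_compare (M : ℕ) (r : Regs) (hS : r.S ^ 3 ≤ B) (hN : r.N ≤ B) (hM : M ≤ B) :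
    Exec B (compare M) ({r with X := 0, F := 0, O := false} : Regs).store
      ({r with X := 0, F := 0, O := decide (r.N < M ∨ r.S ^ 3 ≤ r.N ^ 5)} : Regs).store := by
  have hSB : r.S ≤ B := (Nat.le_self_pow (by norm_num) _).trans hS
  set X₁ := r.S ^ 3 - r.N ^ 5 with hX₁
  -- Emptying `X` for N < M forces acceptance of the short inputs.
  set X₂ := if r.N < M then 0 else X₁ with hX₂
  have hX : X₂ ≤ B := by rw [hX₂]; split <;> omega
  refine Exec.seq (s₂ := ({r with X := r.S ^ 3, F := 0, O := false} : Regs).store) ?_ <|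
    Exec.seq (s₂ := ({r with X := X₁, F := 0, O := false} : Regs).store) ?_ <|
    Exec.seq (s₂ := ({r with X := X₁, F := M, O := false} : Regs).store) (Exec.pushMany M ?_) <|
    Exec.seq (s₂ := ({r with X := X₁, F := M - r.N, O := false} : Regs).store) ?_ <|
    Exec.seq (s₂ := ({r with X := X₂, F := 0, O := false} : Regs).store) ?_ ?_
  · have := Exec.nest (B := B) (x := S) (p := push X true)
      (fun t => ({r with X := t, F := 0, O := false} : Regs).store) r.S hSB (by simp [Regs.store])
      (fun t => Exec.push_eq (by funext v; cases v <;> simp [Regs.store, List.replicate_succ])) 3 0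
    simpa using this
  · have := Exec.nest (B := B) (x := N) (p := pop X)
      (fun t => ({r with X := r.S ^ 3 - t, F := 0, O := false} : Regs).store) r.N hN
      (by simp [Regs.store])
      (fun t => Exec.pop_eq (by funext v; cases v <;> simp [Regs.store, Nat.sub_sub])) 5 0
    simpa using this
  · funext v; cases v <;> simp [Regs.store]
  · have := exec_rep_pop_F (B := B) ({r with X := X₁, F := M, O := false} : Regs) N
      (by simpa [Regs.store])
    simpa [Regs.store] using this
  · by_cases h : r.N < M
    · obtain ⟨d, hd⟩ : ∃ d, M - r.N = d + 1 := Nat.exists_eq_add_one.2 (by omega)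
      rw [hX₂, if_pos h, hd]
      refine Exec.case_eq (some true) (by simp [Regs.store, List.replicate_succ]) ?_
      rw [if_neg (by simp)]
      refine Exec.seq (s₂ := ({r with X := 0, F := d + 1, O := false} : Regs).store)
        (Exec.clr ?_ ?_) (Exec.clr ?_ ?_)
      · simp [Regs.store]; omega
      · funext v; cases v <;> simp [Regs.store]
      · simp [Regs.store]; omega
      · funext v; cases v <;> simp [Regs.store]
    · rw [hX₂, if_neg h, Nat.sub_eq_zero_of_le (by omega)]
      refine Exec.case_eq none (by simp [Regs.store]) ?_
      rw [if_pos rfl]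
      exact Exec.skip _
  · have hiff : (r.N < M ∨ r.S ^ 3 ≤ r.N ^ 5) ↔ X₂ = 0 := by
      rw [hX₂, hX₁]; split <;> omega
    have hO : decide (r.N < M ∨ r.S ^ 3 ≤ r.N ^ 5) = decide (X₂ = 0) := decide_eq_decide.2 hiff
    rw [hO]
    clear hO hiff
    clear_value X₂
    rcases X₂ with _ | d
    · refine Exec.case_eq none (by simp [Regs.store]) ?_
      rw [if_pos rfl]
      refine Exec.push_eq ?_
      funext v; cases v <;> simp [Regs.store]
    · refine Exec.case_eq (some true) (by simp [Regs.store, List.replicate_succ]) ?_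
      rw [if_neg (by simp)]
      refine Exec.clr ?_ ?_
      · simp [Regs.store]; omega
      · funext v; cases v <;> simp [Regs.store]

lemma exec_cleanUp (r : Regs) (hW : r.W.length ≤ B) (hWr : r.Wr.length ≤ B) (hN : r.N ≤ B)
    (hC : r.C ≤ B) (hR : r.R ≤ B) (hS : r.S ≤ B) :
    Exec B cleanUp r.store ({r with W := [], Wr := [], N := 0, C := 0, R := 0, S := 0} :
      Regs).store := by
  refine Exec.seq (s₂ := ({r with W := []} : Regs).store) (Exec.clr hW ?_) <|
    Exec.seq (s₂ := ({r with W := [], Wr := []} : Regs).store) (Exec.clr hWr ?_) <|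
    Exec.seq (s₂ := ({r with W := [], Wr := [], N := 0} : Regs).store)
      (Exec.clr (by simpa [Regs.store]) ?_) <|
    Exec.seq (s₂ := ({r with W := [], Wr := [], N := 0, C := 0} : Regs).store)
      (Exec.clr (by simpa [Regs.store]) ?_) <|
    Exec.seq (s₂ := ({r with W := [], Wr := [], N := 0, C := 0, R := 0} : Regs).store)
      (Exec.clr (by simpa [Regs.store]) ?_) (Exec.clr (by simpa [Regs.store]) ?_) <;>
  · funext v; cases v <;> simp [Regs.store]

/-- The bound on the loops comes from the stack `X`, which holds S³ with S ≤ 2 N², so at most 8 N⁶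
entries; M accounts for the stack `F`. -/
lemma exec_nisanProg (M n : ℕ) (w : List Bool) (hw : w.length = 2 ^ n)
    (hB : 8 * (2 ^ n) ^ 6 + M ≤ B) :
    Exec B (nisanProg M) (Function.update (fun _ => []) W w) (Function.update (fun _ => []) O
      (if 2 ^ n < M ∨ (evenBoxes w (2 ^ ((n + 1) / 2)) (2 ^ (n / 2)) - (2 ^ n) ^ 2) ^ 3 ≤ (2 ^ n) ^ 5
        then [true] else [])) := by
  set E := evenBoxes w (2 ^ ((n + 1) / 2)) (2 ^ (n / 2)) - (2 ^ n) ^ 2 with hE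
  have hRC : 2 ^ ((n + 1) / 2) * 2 ^ (n / 2) = 2 ^ n := by
    rw [← pow_add]; congr 1; omega
  have h1 : 1 ≤ 2 ^ n := Nat.one_le_two_pow
  have hN : 2 ^ n ≤ (2 ^ n) ^ 6 := Nat.le_self_pow (by norm_num) _
  have hN2 : 2 ^ n * 2 ^ n ≤ (2 ^ n) ^ 6 := by
    rw [← sq]; exact Nat.pow_le_pow_right h1 (by norm_num)
  have hC : 2 ^ (n / 2) ≤ 2 ^ n := Nat.pow_le_pow_right (by norm_num) (by omega)
  have hR : 2 ^ ((n + 1) / 2) ≤ 2 ^ n := Nat.pow_le_pow_right (by norm_num) (by omega)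
  have hEle : E ≤ 2 * (2 ^ n * 2 ^ n) := by
    have := evenBoxes_le w (2 ^ ((n + 1) / 2)) (2 ^ (n / 2))
    rw [hRC] at this
    omega
  have hE3 : E ^ 3 ≤ 8 * (2 ^ n) ^ 6 := by
    calc E ^ 3 ≤ (2 * (2 ^ n * 2 ^ n)) ^ 3 := Nat.pow_le_pow_left hEle 3
      _ = _ := by ring
  have e1 : Function.update (fun _ => []) W w = Regs.store {W := w} := by
    funext v; cases v <;> simp [Regs.store]
  have a1 := exec_readInput (B := B) w (by omega)
  rw [hw] at a1
  have a2 := exec_dimensions (B := B) (n := n) {W := w, Wr := w.reverse} (by omega)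
  set r₁ : Regs :=
    {W := w, Wr := w.reverse, N := 2 ^ n, C := 2 ^ (n / 2), R := 2 ^ ((n + 1) / 2)} with hr₁
  have a3 := exec_boxes (B := B) r₁ (by simp [r₁]; omega) (by simp [r₁]; omega)
    (by simp [r₁]; omega) (by simp [r₁]; omega)
  simp only [hr₁, List.reverse_reverse, ← hE] at a3
  have a4 := exec_compare (B := B) M {r₁ with S := E} (by simp; omega)
    (by simp [r₁]; omega) (by omega)
  have a5 := exec_cleanUp (B := B) {r₁ with S := E, O := decide (2 ^ n < M ∨ E ^ 3 ≤ (2 ^ n) ^ 5)}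
    (by simp [r₁]; omega) (by simp [r₁]; omega) (by simp [r₁]; omega) (by simp [r₁]; omega)
    (by simp [r₁]; omega) (by simp; omega)
  have e2 : Function.update (fun _ => []) O
      (if 2 ^ n < M ∨ E ^ 3 ≤ (2 ^ n) ^ 5 then [true] else []) =
      Regs.store {O := decide (2 ^ n < M ∨ E ^ 3 ≤ (2 ^ n) ^ 5)} := by
    funext v; cases v <;> simp [Regs.store]
  rw [e1, e2]
  exact Exec.seq a1 (Exec.seq a2 (Exec.seq a3 (Exec.seq a4 a5)))

end Prog

end MajThrNat

namespace MajThrNat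

/-! ### Averages over random signs -/

section signs

variable {X : Type*} [DecidableEq X]

/-- Changing the sign of the value at one point. -/
lemma involutive_update_neg (x : X) :
    Function.Involutive fun f : X → ℤˣ => Function.update f x (-f x) := fun f => by simp

variable [Fintype X]

/-- Flipping the sign at `x` pairs the summands into opposite ones. -/
lemma sum_sign_mul_eq_zero (x : X) (g : (X → ℤˣ) → ℝ)
    (hg : ∀ f, g (Function.update f x (-f x)) = g f) :
    ∑ f : X → ℤˣ, ((f x : ℤ) : ℝ) * g f = 0 := by
  have h := Equiv.sum_comp (involutive_update_neg x).toPerm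
    fun f : X → ℤˣ => ((f x : ℤ) : ℝ) * g f
  simp only [Function.Involutive.coe_toPerm, hg, Function.update_self, Units.val_neg,
    Int.cast_neg, neg_mul, Finset.sum_neg_distrib] at h
  linarith

lemma sign_mul_self (u : ℤˣ) : ((u : ℤ) : ℝ) * ((u : ℤ) : ℝ) = 1 := by
  rcases Int.units_eq_one_or u with rfl | rfl <;> simp

lemma abs_sign (u : ℤˣ) : |((u : ℤ) : ℝ)| = 1 := by
  rcases Int.units_eq_one_or u with rfl | rfl <;> simp

lemma sum_sign_mul_sign (x y : X) :
    ∑ f : X → ℤˣ, ((f x : ℤ) : ℝ) * ((f y : ℤ) : ℝ) =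
      if x = y then (Fintype.card (X → ℤˣ) : ℝ) else 0 := by
  split_ifs with h
  · subst h
    simp [sign_mul_self]
  · exact sum_sign_mul_eq_zero x _ fun f => by rw [Function.update_of_ne (Ne.symm h)]

end signs

/-! ### The box norm of a matrix -/

section boxSum

variable {α β : Type*} [Fintype α] [Fintype β]

/-- The sum over all combinatorial rectangles of the product of the four entries at the corners. -/
def boxSum (F : α → β → ℝ) : ℝ :=
  ∑ a, ∑ a', ∑ b, ∑ b', F a b * F a b' * F a' b * F a' b'

/-- This gives nonnegativity, which removes the absolute value in Nisan's property and makes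
truncated subtraction harmless in the program. -/
lemma boxSum_eq_sum_sq (F : α → β → ℝ) :
    boxSum F = ∑ a, ∑ a', (∑ b, F a b * F a' b) ^ 2 := by
  refine Finset.sum_congr rfl fun a _ => Finset.sum_congr rfl fun a' _ => ?_
  rw [sq, Finset.sum_mul_sum]
  exact Finset.sum_congr rfl fun b _ => Finset.sum_congr rfl fun b' _ => by ring

lemma boxSum_nonneg (F : α → β → ℝ) : 0 ≤ boxSum F := by
  rw [boxSum_eq_sum_sq]
  positivity

lemma boxSum_swap (F : α → β → ℝ) : boxSum (fun b a => F a b) = boxSum F := by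
  calc boxSum (fun b a => F a b)
      = ∑ b, ∑ b', ∑ a, ∑ a', F a b * F a b' * F a' b * F a' b' := by
        simp only [boxSum]
        exact Finset.sum_congr rfl fun b _ => Finset.sum_congr rfl fun b' _ =>
          Finset.sum_congr rfl fun a _ => Finset.sum_congr rfl fun a' _ => by ring
    _ = ∑ b, ∑ a, ∑ a', ∑ b', F a b * F a b' * F a' b * F a' b' := by
        refine Finset.sum_congr rfl fun b _ => ?_
        rw [Finset.sum_comm]
        exact Finset.sum_congr rfl fun a _ => Finset.sum_comm
    _ = _ := by
        rw [Finset.sum_comm]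
        exact Finset.sum_congr rfl fun a _ => Finset.sum_comm

/-- Cauchy-Schwarz over the rows removes `u`. Expanding the square and taking absolute values
removes `v`, and Cauchy-Schwarz over pairs of columns produces the box sum. -/
lemma sum_mul_rankOne_pow_four_le (F : α → β → ℝ) (u : α → ℝ) (v : β → ℝ) (hu : ∀ a, |u a| ≤ 1)
    (hv : ∀ b, |v b| ≤ 1) :
    (∑ a, ∑ b, F a b * (u a * v b)) ^ 4 ≤
      ((Fintype.card α : ℝ) * Fintype.card β) ^ 2 * boxSum F := by
  have h1 : (∑ a, ∑ b, F a b * (u a * v b)) ^ 2 ≤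
      Fintype.card α * ∑ a, (∑ b, F a b * v b) ^ 2 := by
    have e : ∑ a, ∑ b, F a b * (u a * v b) = ∑ a, u a * ∑ b, F a b * v b := by
      refine Finset.sum_congr rfl fun a _ => ?_
      rw [Finset.mul_sum]
      exact Finset.sum_congr rfl fun b _ => by ring
    rw [e]
    refine (Finset.sum_mul_sq_le_sq_mul_sq _ _ _).trans ?_
    refine mul_le_mul_of_nonneg_right ?_ (by positivity)
    calc ∑ a, u a ^ 2 ≤ ∑ _a : α, (1 : ℝ) :=
          Finset.sum_le_sum fun a _ => (sq_le_one_iff_abs_le_one _).2 (hu a)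
      _ = _ := by simp
  have h2 : ∑ a, (∑ b, F a b * v b) ^ 2 ≤ ∑ b, ∑ b', |∑ a, F a b * F a b'| := by
    have e : ∑ a, (∑ b, F a b * v b) ^ 2 = ∑ b, ∑ b', (v b * v b') * ∑ a, F a b * F a b' := by
      simp_rw [sq, Finset.sum_mul_sum, Finset.mul_sum]
      rw [Finset.sum_comm]
      refine Finset.sum_congr rfl fun b _ => ?_
      rw [Finset.sum_comm]
      exact Finset.sum_congr rfl fun b' _ => Finset.sum_congr rfl fun a _ => by ring
    rw [e]
    refine Finset.sum_le_sum fun b _ => Finset.sum_le_sum fun b' _ => (le_abs_self _).trans ?_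
    rw [abs_mul, abs_mul]
    exact mul_le_of_le_one_left (abs_nonneg _) (mul_le_one₀ (hv b) (abs_nonneg _) (hv b'))
  have h3 : (∑ b, ∑ b', |∑ a, F a b * F a b'|) ^ 2 ≤ (Fintype.card β : ℝ) ^ 2 * boxSum F := by
    rw [← boxSum_swap F, boxSum_eq_sum_sq, ← Fintype.sum_prod_type', ← Fintype.sum_prod_type']
    refine (sq_sum_le_card_mul_sum_sq).trans (le_of_eq ?_)
    simp [sq]
  calc (∑ a, ∑ b, F a b * (u a * v b)) ^ 4 = ((∑ a, ∑ b, F a b * (u a * v b)) ^ 2) ^ 2 := by ring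
    _ ≤ (Fintype.card α * ∑ b, ∑ b', |∑ a, F a b * F a b'|) ^ 2 := by
      refine pow_le_pow_left₀ (by positivity) (h1.trans ?_) 2
      exact mul_le_mul_of_nonneg_left h2 (by positivity)
    _ = Fintype.card α ^ 2 * (∑ b, ∑ b', |∑ a, F a b * F a b'|) ^ 2 := by ring
    _ ≤ Fintype.card α ^ 2 * ((Fintype.card β : ℝ) ^ 2 * boxSum F) := by gcongr
    _ = _ := by ring

/-- `D` bounds the correlation of `F` with all matrices of rank one with entries bounded by `1`. -/
def RankOneBound (F : α → β → ℝ) (D : ℝ) : Prop :=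
  ∀ (u : α → ℝ) (v : β → ℝ), (∀ a, |u a| ≤ 1) → (∀ b, |v b| ≤ 1) →
    |∑ a, ∑ b, F a b * (u a * v b)| ≤ D

lemma exists_rankOneBound (F : α → β → ℝ) : ∃ D : ℝ, 0 ≤ D ∧
    D ^ 4 = ((Fintype.card α : ℝ) * Fintype.card β) ^ 2 * boxSum F ∧ RankOneBound F D := by
  have h0 := boxSum_nonneg F
  have hpow : ((((Fintype.card α : ℝ) * Fintype.card β) ^ 2 * boxSum F) ^ (1 / 4 : ℝ)) ^ 4 =
      ((Fintype.card α : ℝ) * Fintype.card β) ^ 2 * boxSum F := by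
    rw [← Real.rpow_natCast, ← Real.rpow_mul (by positivity)]
    norm_num
  refine ⟨_, by positivity, hpow, fun u v hu hv => ?_⟩
  refine le_of_pow_le_pow_left₀ (n := 4) (by norm_num) (by positivity) ?_
  rw [hpow, Even.pow_abs (by decide)]
  exact sum_mul_rankOne_pow_four_le F u v hu hv

/-- For uniform signs s on `γ`, the mean of s(p a) s(q b) is the indicator of p a = q b. Each choice
of s gives a rank-one matrix bounded by 1, so restricting to the diagonal blocks costs no factor. -/
lemma RankOneBound.diag {F : α → β → ℝ} {D : ℝ} (hD : RankOneBound F D) {γ : Type*} [Fintype γ]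
    [DecidableEq γ] (p : α → γ) (q : β → γ) (u : α → ℝ) (v : β → ℝ) (hu : ∀ a, |u a| ≤ 1)
    (hv : ∀ b, |v b| ≤ 1) :
    |∑ a, ∑ b, F a b * (if p a = q b then u a * v b else 0)| ≤ D := by
  have hc : (0 : ℝ) < Fintype.card (γ → ℤˣ) := by exact_mod_cast Fintype.card_pos
  have e : Fintype.card (γ → ℤˣ) * ∑ a, ∑ b, F a b * (if p a = q b then u a * v b else 0) =
      ∑ s : γ → ℤˣ, ∑ a, ∑ b,
        F a b * ((((s (p a) : ℤ) : ℝ) * u a) * (((s (q b) : ℤ) : ℝ) * v b)) := by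
    symm
    rw [Finset.sum_comm, Finset.mul_sum]
    refine Finset.sum_congr rfl fun a _ => ?_
    rw [Finset.sum_comm, Finset.mul_sum]
    refine Finset.sum_congr rfl fun b _ => ?_
    calc _ = F a b * u a * v b * ∑ s : γ → ℤˣ, ((s (p a) : ℤ) : ℝ) * ((s (q b) : ℤ) : ℝ) := by
          rw [Finset.mul_sum]
          exact Finset.sum_congr rfl fun s _ => by ring
      _ = _ := by
          rw [sum_sign_mul_sign]
          split_ifs <;> ring
  have h : |Fintype.card (γ → ℤˣ) * ∑ a, ∑ b, F a b * (if p a = q b then u a * v b else 0)| ≤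
      Fintype.card (γ → ℤˣ) * D := by
    rw [e]
    refine (Finset.abs_sum_le_sum_abs _ _).trans ?_
    refine (Finset.sum_le_card_nsmul _ _ D fun s _ => hD _ _
      (fun a => by rw [abs_mul, abs_sign, one_mul]; exact hu a)
      (fun b => by rw [abs_mul, abs_sign, one_mul]; exact hv b)).trans (by simp)
  rw [abs_mul, abs_of_pos hc] at h
  exact le_of_mul_le_mul_left h hc

/-- When p < q, exactly one k is the highest bit where they differ: the higher bits agree, q has bit
1 and p has bit 0. The induction halves both numbers, which splits off k = 0. -/
lemma ite_lt_eq_sum (L : ℕ) : ∀ p q : ℕ, q < 2 ^ L → (if p < q then (1 : ℝ) else 0) =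
    ∑ k ∈ Finset.range L, if q / 2 ^ (k + 1) = p / 2 ^ (k + 1) then
      (if q / 2 ^ k % 2 = 1 then (1 : ℝ) else 0) * (if p / 2 ^ k % 2 = 0 then 1 else 0) else 0 := by
  induction L with
  | zero =>
    intro p q hq
    have : ¬ p < q := by simp at hq; omega
    simp [this]
  | succ L ih =>
    intro p q hq
    rw [Finset.sum_range_succ']
    have h := ih (p / 2) (q / 2) (by rw [pow_succ] at hq; omega)
    simp only [Nat.div_div_eq_div_mul, ← pow_succ'] at h
    rw [← h]
    simp only [zero_add, pow_one, pow_zero, Nat.div_one]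
    have hp := Nat.mod_two_eq_zero_or_one p
    split_ifs <;> first | omega | norm_num

lemma RankOneBound.lt {F : α → β → ℝ} {D : ℝ} (hD : RankOneBound F D) (L : ℕ) (p : α → ℕ)
    (q : β → ℕ) (hp : ∀ a, p a < 2 ^ L) (hq : ∀ b, q b < 2 ^ L) :
    |∑ a, ∑ b, F a b * (if q b < p a then 1 else 0)| ≤ L * D := by
  have e : ∑ a, ∑ b, F a b * (if q b < p a then 1 else 0) = ∑ k ∈ Finset.range L, ∑ a, ∑ b,
      F a b * (if (⟨p a / 2 ^ (k + 1), (Nat.div_le_self _ _).trans_lt (hp a)⟩ : Fin (2 ^ L)) =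
        ⟨q b / 2 ^ (k + 1), (Nat.div_le_self _ _).trans_lt (hq b)⟩ then
        (if p a / 2 ^ k % 2 = 1 then (1 : ℝ) else 0) * (if q b / 2 ^ k % 2 = 0 then 1 else 0)
        else 0) := by
    symm
    rw [Finset.sum_comm]
    refine Finset.sum_congr rfl fun a _ => ?_
    rw [Finset.sum_comm]
    refine Finset.sum_congr rfl fun b _ => ?_
    rw [← Finset.mul_sum, ite_lt_eq_sum L _ _ (hp a)]
    simp only [Fin.mk.injEq]
  rw [e]
  refine (Finset.abs_sum_le_sum_abs _ _).trans ?_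
  exact (Finset.sum_le_card_nsmul _ _ D fun k _ => hD.diag _ _ _ _
    (fun a => by split_ifs <;> simp) (fun b => by split_ifs <;> simp)).trans (by simp)

/-- The correlation with a linear threshold matrix. -/
lemma RankOneBound.le {F : α → β → ℝ} {D : ℝ} (hD : RankOneBound F D) (L : ℕ)
    (hL : Fintype.card β < 2 ^ L) (g : α → ℝ) (h : β → ℝ) :
    |∑ a, ∑ b, F a b * (if h b ≤ g a then 1 else 0)| ≤ L * D := by
  classical
  -- Real values become ranks among the values of `h`, strict for columns and weak for rows; ranks
  -- are at most the number of columns, hence fit into L bits.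
  have hiff : ∀ a b, h b ≤ g a ↔ (Finset.univ.filter fun b' => h b' < h b).card <
      (Finset.univ.filter fun b' => h b' ≤ g a).card := by
    intro a b
    constructor
    · intro hab
      refine Finset.card_lt_card (Finset.ssubset_iff_of_subset ?_ |>.2 ⟨b, by simpa, by simp⟩)
      intro b' hb'
      simp only [Finset.mem_filter, Finset.mem_univ, true_and] at hb' ⊢
      linarith
    · intro hlt
      by_contra! hab
      refine hlt.not_ge (Finset.card_le_card fun b' hb' => ?_)
      simp only [Finset.mem_filter, Finset.mem_univ, true_and] at hb' ⊢
      linarith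
  have := hD.lt L (fun a => (Finset.univ.filter fun b' => h b' ≤ g a).card)
    (fun b => (Finset.univ.filter fun b' => h b' < h b).card)
    (fun a => (Finset.card_le_univ _).trans_lt hL) (fun b => (Finset.card_le_univ _).trans_lt hL)
  simpa only [← hiff] using this

end boxSum

end MajThrNat

namespace MajThrNat

/-! ### Nisan's property in terms of the box norm -/

section nisan

variable {n : ℕ} (P : BalancedPartition n) (f : BoolFn n)

/-- The matrix of a function with respect to a partition of the inputs. -/
def signMatrix (a : {i // i ∈ P.A} → Bool) (b : {i // i ∉ P.A} → Bool) : ℝ :=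
  ((f (merge P a b) : ℤ) : ℝ)

lemma card_left : Fintype.card ({i // i ∈ P.A} → Bool) = 2 ^ ((n + 1) / 2) := by
  simp [P.card_A]

lemma card_right : Fintype.card ({i // i ∉ P.A} → Bool) = 2 ^ (n / 2) := by
  have : Fintype.card {i // i ∉ P.A} = n / 2 := by
    rw [Fintype.card_subtype_compl]
    simp only [Fintype.card_fin, Fintype.card_coe, P.card_A]
    omega
  rw [Fintype.card_fun, this, Fintype.card_bool]

lemma card_left_mul_card_right : (Fintype.card ({i // i ∈ P.A} → Bool) : ℝ) *
    Fintype.card ({i // i ∉ P.A} → Bool) = 2 ^ n := by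
  rw [card_left, card_right]
  push_cast
  rw [← pow_add]
  congr 1
  omega

lemma sum_bool_arrow {α : Type*} [Fintype α] (g : α → α → ℝ) :
    ∑ x : Bool → α, g (x true) (x false) = ∑ a, ∑ a', g a a' := by
  rw [← Fintype.sum_prod_type']
  refine Fintype.sum_equiv ((Equiv.boolArrowEquivProd α).trans (Equiv.prodComm _ _)) _ _ fun x => ?_
  simp

lemma twoPartyNorm_eq : twoPartyNorm P f = boxSum (signMatrix P f) / (2 ^ n) ^ 2 := by
  unfold twoPartyNorm
  simp only [Fintype.expect_eq_sum_div_card, Fintype.prod_bool]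
  rw [← Finset.sum_div, div_div]
  congr 1
  · have h := sum_bool_arrow (α := {i // i ∈ P.A} → Bool) fun a a' =>
      ∑ x : Bool → {i // i ∉ P.A} → Bool,
        signMatrix P f a (x true) * signMatrix P f a (x false) *
          (signMatrix P f a' (x true) * signMatrix P f a' (x false))
    refine h.trans (Finset.sum_congr rfl fun a _ => Finset.sum_congr rfl fun a' _ => ?_)
    refine (sum_bool_arrow fun b b' => signMatrix P f a b * signMatrix P f a b' *
          (signMatrix P f a' b * signMatrix P f a' b')).trans ?_
    exact Finset.sum_congr rfl fun b _ => Finset.sum_congr rfl fun b' _ => by ring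
  · rw [← card_left_mul_card_right P]
    simp only [Fintype.card_fun (α := Bool), Fintype.card_bool]
    push_cast
    ring

lemma two_rpow_eq : (2 : ℝ) ^ n * 2 ^ (2 * (n : ℝ) / 3) = 2 ^ (5 * (n : ℝ) / 3) := by
  rw [← Real.rpow_natCast, ← Real.rpow_add (by norm_num)]
  congr 1
  ring

lemma mem_nisanProperty_iff (P : ∀ n, BalancedPartition n) :
    f ∈ nisanProperty P n ↔ boxSum (signMatrix (P n) f) ≤ 2 ^ (5 * (n : ℝ) / 3) := by
  have h2 : (0 : ℝ) < 2 ^ n := by positivity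
  have h : (2 : ℝ) ^ n * twoPartyNorm (P n) f = boxSum (signMatrix (P n) f) / 2 ^ n := by
    rw [twoPartyNorm_eq]
    field_simp
  rw [nisanProperty, Set.mem_ofPred_eq, h, abs_of_nonneg (div_nonneg (boxSum_nonneg _) h2.le),
    div_le_iff₀ h2, mul_comm, two_rpow_eq]

end nisan

/-! ### Usefulness -/

section useful

variable {n : ℕ} (P : BalancedPartition n) {f : BoolFn n}

lemma sum_merge (w : Fin n → ℝ) (a : {i // i ∈ P.A} → Bool) (b : {i // i ∉ P.A} → Bool) :
    ∑ i, w i * (if merge P a b i then 1 else 0) =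
      ∑ i : {i // i ∈ P.A}, w i * (if a i then 1 else 0) +
      ∑ i : {i // i ∉ P.A}, w i * (if b i then 1 else 0) := by
  rw [← Fintype.sum_subtype_add_sum_subtype (fun i => i ∈ P.A)]
  congr 1
  · exact Finset.sum_congr (by ext; simp) fun i _ => by rw [merge, dif_pos i.2]
  · exact Finset.sum_congr (by ext; simp) fun i _ => by rw [merge, dif_neg i.2]

lemma RankOneBound.thrGate {D : ℝ} (hD : RankOneBound (signMatrix P f) D) (w : Fin n → ℝ) (θ : ℝ) :
    |∑ a, ∑ b, signMatrix P f a b * (if thrGate w θ (merge P a b) then 1 else 0)| ≤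
      ((n / 2 + 1 : ℕ) : ℝ) * D := by
  have := hD.le (n / 2 + 1) (by rw [card_right]; exact Nat.pow_lt_pow_right (by norm_num) (by omega))
    (fun a => ∑ i : {i // i ∈ P.A}, w i * (if a i then 1 else 0))
    (fun b => θ - ∑ i : {i // i ∉ P.A}, w i * (if b i then 1 else 0))
  convert this using 8 with a _ b _
  simp only [MajThrNat.thrGate, sum_merge, decide_eq_true_eq, sub_le_iff_le_add]

/-- The shift by 1/2 settles ties: twice the vote count minus m is nonnegative when the gate fires,
and at most -1 by integrality when it does not. -/
lemma half_le_sign_mul {m : ℕ} (y : Fin m → Bool) :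
    1 / 2 ≤ ((signOf (majGate y) : ℤ) : ℝ) *
      (2 * ∑ j, (if y j then (1 : ℝ) else 0) + (1 / 2 - m)) := by
  set c := (Finset.univ.filter fun j => y j).card with hc
  have hs : ∑ j, (if y j then (1 : ℝ) else 0) = c := by simp [hc]
  have hm : majGate y = decide ((m : ℝ) / 2 ≤ c) := by
    simp [majGate, thrGate, ← hs]
  rw [hm, hs]
  by_cases h : (m : ℝ) / 2 ≤ c
  · simp only [h, decide_true, signOf, if_true, Units.val_one, Int.cast_one]
    linarith
  · have h' : 2 * c + 1 ≤ m := by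
      have : (2 * c : ℝ) < m := by linarith
      exact_mod_cast this
    have h'' : (2 * c + 1 : ℝ) ≤ m := by exact_mod_cast h'
    simp only [h, decide_false, signOf, Bool.false_eq_true, if_false, Units.val_neg, Units.val_one,
      Int.cast_neg, Int.cast_one]
    linarith

lemma le_boxSum_of_majority {m : ℕ} (w : Fin m → Fin n → ℝ) (θ : Fin m → ℝ)
    (hf : ∀ x, f x = signOf (majGate fun j => thrGate (w j) (θ j) x)) :
    ((2 : ℝ) ^ n) ^ 2 ≤ (4 * m * (n / 2 + 1 : ℕ) + 2 * m + 1) ^ 4 * boxSum (signMatrix P f) := by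
  obtain ⟨D, hD0, hD4, hD⟩ := exists_rankOneBound (signMatrix P f)
  rw [card_left_mul_card_right] at hD4
  have h1 : (2 : ℝ) ^ n * (1 / 2) ≤ ∑ a, ∑ b, signMatrix P f a b *
      (2 * ∑ j, (if thrGate (w j) (θ j) (merge P a b) then (1 : ℝ) else 0) + (1 / 2 - m)) := by
    calc (2 : ℝ) ^ n * (1 / 2) = ∑ _a : {i // i ∈ P.A} → Bool, ∑ _b : {i // i ∉ P.A} → Bool,
          (1 / 2 : ℝ) := by
          rw [← card_left_mul_card_right P]
          simp only [Finset.sum_const, Finset.card_univ, nsmul_eq_mul, mul_assoc]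
      _ ≤ _ := Finset.sum_le_sum fun a _ => Finset.sum_le_sum fun b _ => by
          rw [signMatrix, hf]
          exact half_le_sign_mul _
  have h2 : ∑ a, ∑ b, signMatrix P f a b *
      (2 * ∑ j, (if thrGate (w j) (θ j) (merge P a b) then (1 : ℝ) else 0) + (1 / 2 - m)) =
      2 * ∑ j, ∑ a, ∑ b, signMatrix P f a b *
        (if thrGate (w j) (θ j) (merge P a b) then (1 : ℝ) else 0) +
      (1 / 2 - m) * ∑ a, ∑ b, signMatrix P f a b * (1 * 1) := by
    have e : ∑ j, ∑ a, ∑ b, signMatrix P f a b *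
        (if thrGate (w j) (θ j) (merge P a b) then (1 : ℝ) else 0) =
        ∑ a, ∑ b, signMatrix P f a b *
          ∑ j, (if thrGate (w j) (θ j) (merge P a b) then (1 : ℝ) else 0) := by
      rw [Finset.sum_comm]
      refine Finset.sum_congr rfl fun a _ => ?_
      rw [Finset.sum_comm]
      exact Finset.sum_congr rfl fun b _ => by rw [Finset.mul_sum]
    rw [e]
    simp only [Finset.mul_sum, ← Finset.sum_add_distrib]
    refine Finset.sum_congr rfl fun a _ => Finset.sum_congr rfl fun b _ => ?_
    rw [← Finset.mul_sum, ← Finset.mul_sum, ← Finset.mul_sum]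
    ring
  have h3 : ∑ j, ∑ a, ∑ b, signMatrix P f a b *
      (if thrGate (w j) (θ j) (merge P a b) then (1 : ℝ) else 0) ≤
      m * (((n / 2 + 1 : ℕ) : ℝ) * D) := by
    refine (Finset.sum_le_card_nsmul _ _ _ fun j _ =>
      (le_abs_self _).trans (hD.thrGate P (w j) (θ j))).trans (by simp)
  have h4 : (1 / 2 - m : ℝ) * ∑ a, ∑ b, signMatrix P f a b * (1 * 1) ≤ (m + 1 / 2) * D := by
    refine (le_abs_self _).trans ?_
    rw [abs_mul]
    refine mul_le_mul ?_ (hD (fun _ => 1) (fun _ => 1) (by simp) (by simp)) (abs_nonneg _)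
      (by positivity)
    rw [abs_le]
    constructor <;> linarith [(Nat.cast_nonneg m : (0 : ℝ) ≤ m)]
  have h5 : (2 : ℝ) ^ n ≤ (4 * m * (n / 2 + 1 : ℕ) + 2 * m + 1) * D := by
    rw [h2] at h1
    linarith
  -- The fourth power brings in D^4 = 4^n `boxSum`, and one factor 4^n cancels.
  have h6 : ((2 : ℝ) ^ n) ^ 4 ≤
      ((4 * m * (n / 2 + 1 : ℕ) + 2 * m + 1) ^ 4 * boxSum (signMatrix P f)) * ((2 : ℝ) ^ n) ^ 2 := by
    calc ((2 : ℝ) ^ n) ^ 4 ≤ ((4 * m * (n / 2 + 1 : ℕ) + 2 * m + 1) * D) ^ 4 := by gcongr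
      _ = _ := by rw [mul_pow, hD4]; ring
  refine le_of_mul_le_mul_right ?_ (show (0 : ℝ) < ((2 : ℝ) ^ n) ^ 2 by positivity)
  calc _ = ((2 : ℝ) ^ n) ^ 4 := by ring
    _ ≤ _ := h6

/-- The base 2n + 7 bounds 4 (n/2 + 1) + 2 + 1, the loss from thresholds and majority per gate. -/
lemma eventually_pow_lt_rpow :
    ∀ᶠ n : ℕ in Filter.atTop, (2 * (n : ℝ) + 7) ^ 4 < 2 ^ ((n : ℝ) / 6) := by
  have hr : (1 : ℝ) < 2 ^ (1 / 6 : ℝ) := Real.one_lt_rpow (by norm_num) (by norm_num)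
  have h := tendsto_pow_const_div_const_pow_of_one_lt 4 hr
  filter_upwards [h.eventually_lt_const (show (0 : ℝ) < 1 / 9 ^ 4 by norm_num),
    Filter.eventually_ge_atTop 1] with n hn h1
  have e : (2 : ℝ) ^ ((n : ℝ) / 6) = (2 ^ (1 / 6 : ℝ)) ^ n := by
    rw [← Real.rpow_natCast, ← Real.rpow_mul (by norm_num)]
    congr 1
    ring
  have h1' : (1 : ℝ) ≤ n := by exact_mod_cast h1
  rw [e]
  rw [div_lt_div_iff₀ (by positivity) (by positivity)] at hn
  calc (2 * (n : ℝ) + 7) ^ 4 ≤ (9 * (n : ℝ)) ^ 4 := by gcongr; linarith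
    _ = (n : ℝ) ^ 4 * 9 ^ 4 := by ring
    _ < _ := by linarith

lemma useful_nisanProperty (P : ∀ n, BalancedPartition n) :
    Useful (fun n => majThr ((2 : ℝ) ^ ((n : ℝ) / (24 : ℕ))) n) (nisanProperty P) := by
  intro f
  filter_upwards [eventually_pow_lt_rpow] with n hn
  rintro ⟨m, hm, w, θ, hf⟩ hmem
  rw [mem_nisanProperty_iff] at hmem
  have h1 := le_boxSum_of_majority (P n) w θ hf
  set M : ℝ := 2 ^ ((n : ℝ) / (24 : ℕ)) with hM
  have hM1 : 1 ≤ M := Real.one_le_rpow (by norm_num) (by positivity)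
  have hM4 : M ^ 4 = 2 ^ ((n : ℝ) / 6) := by
    rw [hM, ← Real.rpow_natCast, ← Real.rpow_mul (by norm_num)]
    congr 1
    push_cast
    ring
  have hn2 : ((n / 2 + 1 : ℕ) : ℝ) ≤ n / 2 + 1 := by
    push_cast
    linarith [(Nat.cast_div_le : ((n / 2 : ℕ) : ℝ) ≤ n / (2 : ℕ))]
  have h2 : (4 * m * (n / 2 + 1 : ℕ) + 2 * m + 1 : ℝ) ≤ M * (2 * n + 7) := by
    have : (m : ℝ) * (n / 2 + 1 : ℕ) ≤ M * (n / 2 + 1) := by gcongr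
    linarith
  -- The exponents are 1/6 from M^4, 1/6 from the polynomial and 5/3 from Nisan's property. They add
  -- up to exactly 2, so strictness gives the contradiction.
  have h3 : ((2 : ℝ) ^ n) ^ 2 <
      (2 : ℝ) ^ ((n : ℝ) / 6) * 2 ^ ((n : ℝ) / 6) * 2 ^ (5 * (n : ℝ) / 3) := by
    calc ((2 : ℝ) ^ n) ^ 2 ≤ (M * (2 * (n : ℝ) + 7)) ^ 4 * (2 : ℝ) ^ (5 * (n : ℝ) / 3) := by
          refine h1.trans ?_
          gcongr
          exact boxSum_nonneg _
      _ = (2 : ℝ) ^ ((n : ℝ) / 6) * (2 * (n : ℝ) + 7) ^ 4 * (2 : ℝ) ^ (5 * (n : ℝ) / 3) := by rw [mul_pow, hM4]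
      _ < _ := by gcongr
  rw [← Real.rpow_add (by norm_num), ← Real.rpow_add (by norm_num), ← Real.rpow_natCast,
    ← Real.rpow_natCast, ← Real.rpow_mul (by norm_num)] at h3
  refine h3.ne (congrArg _ ?_)
  push_cast
  ring

end useful

/-! ### Largeness -/

section large

variable {n : ℕ} (P : BalancedPartition n)

lemma merge_inj {a a' : {i // i ∈ P.A} → Bool} {b b' : {i // i ∉ P.A} → Bool}
    (h : merge P a b = merge P a' b') : a = a' ∧ b = b' := by
  constructor
  · funext i
    have := congrFun h i
    rwa [merge, merge, dif_pos i.2, dif_pos i.2] at this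
  · funext i
    have := congrFun h i
    rwa [merge, merge, dif_neg i.2, dif_neg i.2] at this

/-- In a nondegenerate box the corner (a, b) differs from the other three, so its random sign makes
the mean vanish; a degenerate box contributes at most 1 per function. -/
lemma sum_box_le (a a' : {i // i ∈ P.A} → Bool) (b b' : {i // i ∉ P.A} → Bool) :
    ∑ f : BoolFn n, signMatrix P f a b * signMatrix P f a b' * signMatrix P f a' b *
      signMatrix P f a' b' ≤
      Fintype.card (BoolFn n) * ((if a = a' then 1 else 0) + (if b = b' then 1 else 0)) := by
  by_cases h : a = a' ∨ b = b'
  · calc _ ≤ ∑ _f : BoolFn n, (1 : ℝ) := Finset.sum_le_sum fun f _ => ?_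
      _ = Fintype.card (BoolFn n) * 1 := by simp
      _ ≤ _ := by
        gcongr
        rcases h with h | h
        · rw [if_pos h]; split_ifs <;> norm_num
        · rw [if_pos h]; split_ifs <;> norm_num
    refine (le_abs_self _).trans (le_of_eq ?_)
    simp only [signMatrix, abs_mul, abs_sign, one_mul]
  · push Not at h
    have := sum_sign_mul_eq_zero (merge P a b) fun f : BoolFn n =>
      signMatrix P f a b' * signMatrix P f a' b * signMatrix P f a' b'
    rw [if_neg h.1, if_neg h.2, add_zero, mul_zero]
    refine le_of_eq (Eq.trans ?_ (this fun f => ?_))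
    · exact Finset.sum_congr rfl fun f _ => by simp only [signMatrix]; ring
    · simp only [signMatrix]
      rw [Function.update_of_ne fun e => h.2 (merge_inj P e).2.symm,
        Function.update_of_ne fun e => h.1 (merge_inj P e).1.symm,
        Function.update_of_ne fun e => h.1 (merge_inj P e).1.symm]

lemma sum_boxSum_le : ∑ f : BoolFn n, boxSum (signMatrix P f) ≤
    Fintype.card (BoolFn n) * (2 ^ n * (2 ^ ((n + 1) / 2) + 2 ^ (n / 2))) := by
  have e : ∑ f : BoolFn n, boxSum (signMatrix P f) = ∑ a, ∑ a', ∑ b, ∑ b', ∑ f : BoolFn n,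
      signMatrix P f a b * signMatrix P f a b' * signMatrix P f a' b * signMatrix P f a' b' := by
    unfold boxSum
    rw [Finset.sum_comm]
    refine Finset.sum_congr rfl fun a _ => ?_
    rw [Finset.sum_comm]
    refine Finset.sum_congr rfl fun a' _ => ?_
    rw [Finset.sum_comm]
    refine Finset.sum_congr rfl fun b _ => ?_
    rw [Finset.sum_comm]
  rw [e]
  refine (Finset.sum_le_sum fun a _ => Finset.sum_le_sum fun a' _ => Finset.sum_le_sum fun b _ =>
    Finset.sum_le_sum fun b' _ => sum_box_le P a a' b b').trans (le_of_eq ?_)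
  simp only [← Finset.mul_sum]
  congr 1
  simp only [Finset.sum_add_distrib, Finset.sum_const, Finset.card_univ, Finset.sum_ite_eq,
    Finset.mem_univ, if_true, nsmul_eq_mul, mul_one, ← Finset.mul_sum]
  rw [← card_left_mul_card_right P, card_left, card_right]
  push_cast
  ring

lemma large_nisanProperty (P : ∀ n, BalancedPartition n) (hn : 15 ≤ n) :
    LargeAt (1 / 2) (nisanProperty P n) := by
  classical
  set T : ℝ := 2 ^ (5 * (n : ℝ) / 3) with hT
  have hT0 : 0 < T := by positivity
  have hS := sum_boxSum_le (P n)
  have hpow : (2 : ℝ) ^ n * (2 ^ ((n + 1) / 2) + 2 ^ (n / 2)) ≤ T / 2 := by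
    -- Here (n + 1)/2 ≤ 2n/3 - 2 is equivalent to n ≥ 15. The spare factor 1/4 pays for the two
    -- summands and for the 1/2 in Markov's inequality.
    have h1 : (2 : ℝ) ^ ((n + 1) / 2) ≤ 2 ^ (2 * (n : ℝ) / 3 - 2) := by
      rw [← Real.rpow_natCast]
      refine Real.rpow_le_rpow_of_exponent_le (by norm_num) ?_
      have : (((n + 1) / 2 : ℕ) : ℝ) ≤ ((n + 1 : ℕ) : ℝ) / (2 : ℕ) := Nat.cast_div_le
      push_cast at this
      have : (15 : ℝ) ≤ n := by exact_mod_cast hn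
      linarith
    have h2 : (2 : ℝ) ^ (n / 2) ≤ 2 ^ ((n + 1) / 2) :=
      pow_le_pow_right₀ (by norm_num) (by omega)
    have h3 : (2 : ℝ) ^ (2 * (n : ℝ) / 3 - 2) = 2 ^ (2 * (n : ℝ) / 3) / 4 := by
      rw [Real.rpow_sub (by norm_num)]
      norm_num
    calc (2 : ℝ) ^ n * (2 ^ ((n + 1) / 2) + 2 ^ (n / 2))
        ≤ 2 ^ n * (2 ^ (2 * (n : ℝ) / 3) / 2) := by gcongr; linarith
      _ = T / 2 := by rw [hT, ← two_rpow_eq]; ring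
  set Bad : Finset (BoolFn n) := Finset.univ.filter fun f => f ∉ nisanProperty P n with hBad
  have hbad : (Bad.card : ℝ) * T ≤ ∑ f : BoolFn n, boxSum (signMatrix (P n) f) := by
    calc (Bad.card : ℝ) * T = ∑ _f ∈ Bad, T := by simp
      _ ≤ ∑ f ∈ Bad, boxSum (signMatrix (P n) f) := by
        refine Finset.sum_le_sum fun f hf => ?_
        have := (Finset.mem_filter.1 hf).2
        rw [mem_nisanProperty_iff, not_le] at this
        exact this.le
      _ ≤ _ := Finset.sum_le_sum_of_subset_of_nonneg (Finset.subset_univ _)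
        fun f _ _ => boxSum_nonneg _
  have hle : (Bad.card : ℝ) ≤ Fintype.card (BoolFn n) / 2 := by
    refine le_of_mul_le_mul_right ?_ hT0
    calc (Bad.card : ℝ) * T ≤ Fintype.card (BoolFn n) * (T / 2) :=
          (hbad.trans hS).trans (by gcongr)
      _ = _ := by ring
  have hcard : (nisanProperty P n).ncard + Bad.card = Fintype.card (BoolFn n) := by
    rw [Set.ncard_eq_toFinset_card', ← Finset.card_univ,
      ← Finset.card_filter_add_card_filter_not (s := Finset.univ) (fun f => f ∈ nisanProperty P n)]
    congr 2
    ext f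
    simp
  have hcard' : ((nisanProperty P n).ncard : ℝ) + Bad.card = Fintype.card (BoolFn n) := by
    exact_mod_cast hcard
  rw [LargeAt, Nat.card_eq_fintype_card]
  linarith

end large

end MajThrNat

namespace MajThrNat

/-! ### Constructivity -/

section constructive

lemma boxSum_comp {α β γ δ : Type*} [Fintype α] [Fintype β] [Fintype γ] [Fintype δ]
    (F : α → β → ℝ) {e : γ → α} {e' : δ → β} (he : e.Bijective) (he' : e'.Bijective) :
    boxSum (fun x y => F (e x) (e' y)) = boxSum F :=
  Fintype.sum_bijective e he _ _ fun _ => Fintype.sum_bijective e he _ _ fun _ =>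
    Fintype.sum_bijective e' he' _ _ fun _ => Fintype.sum_bijective e' he' _ _ fun _ => rfl

/-- Positions covering all k bits determine a number below 2^k; counting then gives surjectivity. -/
lemma bijective_testBit {ι : Type*} [Fintype ι] [DecidableEq ι] {k : ℕ} (hk : Fintype.card (ι → Bool) = 2 ^ k)
    (pos : ι → ℕ) (hpos : ∀ j < k, ∃ i, pos i = j) :
    Function.Bijective fun (x : Fin (2 ^ k)) (i : ι) => (x : ℕ).testBit (pos i) := by
  rw [Fintype.bijective_iff_injective_and_card]
  refine ⟨fun x y h => Fin.ext (Nat.eq_of_testBit_eq fun j => ?_), ?_⟩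
  · by_cases hj : j < k
    · obtain ⟨i, rfl⟩ := hpos j hj
      exact congrFun h i
    · have hle : 2 ^ k ≤ 2 ^ j := Nat.pow_le_pow_right (by norm_num) (by omega)
      rw [Nat.testBit_lt_two_pow (x.2.trans_le hle), Nat.testBit_lt_two_pow (y.2.trans_le hle)]
  · rw [Fintype.card_fin, hk]

variable {n : ℕ}

lemma length_truthTable (f : BoolFn n) : (truthTable f).length = 2 ^ n := by
  simp [truthTable]

lemma mem_firstHalf {i : Fin n} : i ∈ (firstHalf n).A ↔ (i : ℕ) < (n + 1) / 2 := by
  simp [firstHalf]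

/-- The `A`-part of an input with the binary expansion `a`. -/
def leftInput (a : Fin (2 ^ ((n + 1) / 2))) (i : {i // i ∈ (firstHalf n).A}) : Bool :=
  (a : ℕ).testBit ((n + 1) / 2 - 1 - i.1)

/-- The `B`-part of an input with the binary expansion `b`. -/
def rightInput (b : Fin (2 ^ (n / 2))) (i : {i // i ∉ (firstHalf n).A}) : Bool :=
  (b : ℕ).testBit (n - 1 - i.1)

lemma bijective_leftInput : (leftInput (n := n)).Bijective := by
  refine bijective_testBit (card_left _) (fun i : {i // i ∈ (firstHalf n).A} =>
    (n + 1) / 2 - 1 - i.1) fun j hj => ?_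
  refine ⟨⟨⟨(n + 1) / 2 - 1 - j, by omega⟩, mem_firstHalf.2 (by simp; omega)⟩, ?_⟩
  simp only
  omega

lemma bijective_rightInput : (rightInput (n := n)).Bijective := by
  refine bijective_testBit (card_right _) (fun i : {i // i ∉ (firstHalf n).A} =>
    n - 1 - i.1) fun j hj => ?_
  refine ⟨⟨⟨n - 1 - j, by omega⟩, fun h => ?_⟩, ?_⟩
  · have := mem_firstHalf.1 h
    simp only at this
    omega
  · simp only
    omega

/-- The first input is the most significant digit, so the first half of the inputs forms the high
digits `a` of the index and the rest the low digits `b`. -/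
lemma getD_truthTable (f : BoolFn n) (a : Fin (2 ^ ((n + 1) / 2))) (b : Fin (2 ^ (n / 2))) :
    (truthTable f).getD (a * 2 ^ (n / 2) + b) false =
      decide (f (merge (firstHalf n) (leftInput a) (rightInput b)) = 1) := by
  have hlt : (a : ℕ) * 2 ^ (n / 2) + b < 2 ^ n := by
    calc (a : ℕ) * 2 ^ (n / 2) + b < a * 2 ^ (n / 2) + 2 ^ (n / 2) := by omega
      _ = (a + 1) * 2 ^ (n / 2) := by ring
      _ ≤ 2 ^ ((n + 1) / 2) * 2 ^ (n / 2) := Nat.mul_le_mul_right _ a.2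
      _ = 2 ^ n := by rw [← pow_add]; congr 1; omega
  have hx : (fun i : Fin n => ((a : ℕ) * 2 ^ (n / 2) + b).testBit (n - 1 - i)) =
      merge (firstHalf n) (leftInput a) (rightInput b) := by
    funext i
    rw [mul_comm, Nat.testBit_two_pow_mul_add _ b.2]
    have hi := i.2
    by_cases h : i ∈ (firstHalf n).A
    · rw [merge, dif_pos h, leftInput]
      have := mem_firstHalf.1 h
      rw [if_neg (by omega)]
      congr 1
      simp only
      omega
    · rw [merge, dif_neg h, rightInput]
      have := mt mem_firstHalf.2 h
      rw [if_pos (by omega)]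
  rw [List.getD_eq_getElem _ _ (by rw [length_truthTable]; exact hlt)]
  simp only [truthTable, List.getElem_ofFn, hx]

lemma sign_eq (u : ℤˣ) : ((u : ℤ) : ℝ) = if decide (u = 1) then 1 else -1 := by
  rcases Int.units_eq_one_or u with rfl | rfl <;> simp

/-- A product of four signs is 2 - 1 for even parity and 0 - 1 for odd parity, and there are (2^n)²
boxes. -/
lemma boxSum_firstHalf (f : BoolFn n) :
    boxSum (signMatrix (firstHalf n) f) =
      (Prog.evenBoxes (truthTable f) (2 ^ ((n + 1) / 2)) (2 ^ (n / 2)) : ℝ) - ((2 : ℝ) ^ n) ^ 2 := by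
  have hone : ((2 : ℝ) ^ n) ^ 2 = ∑ _a : Fin (2 ^ ((n + 1) / 2)), ∑ _a' : Fin (2 ^ ((n + 1) / 2)),
      ∑ _b : Fin (2 ^ (n / 2)), ∑ _b' : Fin (2 ^ (n / 2)), (1 : ℝ) := by
    rw [← card_left_mul_card_right (firstHalf n), card_left, card_right]
    simp
    ring
  rw [← boxSum_comp _ bijective_leftInput bijective_rightInput, hone, Prog.evenBoxes]
  simp only [Finset.sum_range, Nat.cast_sum, ← Finset.sum_sub_distrib, boxSum, getD_truthTable,
    signMatrix]
  refine Finset.sum_congr rfl fun a _ => Finset.sum_congr rfl fun a' _ =>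
    Finset.sum_congr rfl fun b _ => Finset.sum_congr rfl fun b' _ => ?_
  simp only [sign_eq]
  generalize decide (f (merge (firstHalf n) (leftInput a) (rightInput b)) = 1) = p
  generalize decide (f (merge (firstHalf n) (leftInput a) (rightInput b')) = 1) = q
  generalize decide (f (merge (firstHalf n) (leftInput a') (rightInput b)) = 1) = p'
  generalize decide (f (merge (firstHalf n) (leftInput a') (rightInput b')) = 1) = q'
  cases p <;> cases q <;> cases p' <;> cases q' <;> norm_num

/-- Cubing both sides turns the bound 2^(5n/3) into an integer. -/
lemma mem_nisanProperty_firstHalf_iff (f : BoolFn n) : f ∈ nisanProperty firstHalf n ↔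
    (Prog.evenBoxes (truthTable f) (2 ^ ((n + 1) / 2)) (2 ^ (n / 2)) - (2 ^ n) ^ 2) ^ 3 ≤
      (2 ^ n) ^ 5 := by
  have h0 := boxSum_nonneg (signMatrix (firstHalf n) f)
  rw [mem_nisanProperty_iff, boxSum_firstHalf]
  rw [boxSum_firstHalf] at h0
  set E := Prog.evenBoxes (truthTable f) (2 ^ ((n + 1) / 2)) (2 ^ (n / 2))
  have hle : (2 ^ n) ^ 2 ≤ E := by
    have : ((2 : ℝ) ^ n) ^ 2 ≤ E := by linarith
    exact_mod_cast this
  have hcast : (E : ℝ) - ((2 : ℝ) ^ n) ^ 2 = ((E - (2 ^ n) ^ 2 : ℕ) : ℝ) := by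
    rw [Nat.cast_sub hle]
    push_cast
    rfl
  have h5 : ((2 : ℝ) ^ (5 * (n : ℝ) / 3)) ^ 3 = (((2 ^ n) ^ 5 : ℕ) : ℝ) := by
    push_cast
    rw [← Real.rpow_natCast, ← Real.rpow_mul (by norm_num), ← Real.rpow_natCast 2 n,
      ← Real.rpow_natCast _ 5, ← Real.rpow_mul (by norm_num)]
    congr 1
    push_cast
    ring
  rw [hcast, ← pow_le_pow_iff_left₀ (by positivity) (by positivity) (show 3 ≠ 0 by norm_num), h5]
  norm_cast

lemma constructive_of_iff (M : ℕ) (Q : ∀ n, Set (BoolFn n))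
    (hQ : ∀ n (f : BoolFn n), f ∈ Q n ↔ 2 ^ n < M ∨ f ∈ nisanProperty firstHalf n) :
    Constructive Q := by
  refine Prog.computableInPolyTime _ _ (Prog.nisanProg M) .W .O
    (8 * Polynomial.X ^ 6 + Polynomial.C M) fun p => ?_
  have h := Prog.exec_nisanProg (B := 8 * (2 ^ p.1) ^ 6 + M) M p.1 (truthTable p.2)
    (length_truthTable _) le_rfl
  have hB : (8 * Polynomial.X ^ 6 + Polynomial.C M : Polynomial ℕ).eval (truthTable p.2).length =
      8 * (2 ^ p.1) ^ 6 + M := by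
    rw [length_truthTable]
    simp
  rw [hB]
  simpa only [decide_eq_true_eq, hQ, mem_nisanProperty_firstHalf_iff] using h

end constructive

theorem useful_if_nisanProperty (n₀ : ℕ) (Λ : ∀ n, Set (BoolFn n))
    (h : Useful Λ (nisanProperty firstHalf)) :
    Useful Λ fun n => if n < n₀ then Set.univ else nisanProperty firstHalf n := by
  intro f
  filter_upwards [h f, Filter.eventually_ge_atTop n₀] with n hn hge
  rwa [if_neg (not_lt.2 hge)]

end MajThrNat

theorem mainTheorem4 :
    ∃ c n₀ : ℕ, 0 < c ∧
      -- Nisan's property, for every choice of balanced partitions: largeness and usefulness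
      (∀ P : ∀ n, BalancedPartition n,
        (∀ n, n₀ ≤ n → LargeAt (1 / 2) (nisanProperty P n)) ∧
        Useful (fun n => majThr ((2 : ℝ) ^ ((n : ℝ) / c)) n) (nisanProperty P)) ∧
      -- Nisan's property for the partition into the first and the second half: constructivity
      Constructive (nisanProperty firstHalf) ∧
      -- the property of density 1/2 at every length, equal to Nisan's at all lengths `n ≥ n₀`
      IsNaturalProperty (fun n => majThr ((2 : ℝ) ^ ((n : ℝ) / c)) n) (fun _ => 1 / 2)
        (fun n => if n < n₀ then Set.univ else nisanProperty firstHalf n) := by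
  -- With c = 24 the fourth power of the fan-in is at most 2^(n/6); n₀ = 15 comes from largeness.
  -- The cutoff M = 0 accepts no input for being short.
  refine ⟨24, 15, by norm_num, fun P => ⟨fun n hn => large_nisanProperty P hn,
    useful_nisanProperty P⟩, constructive_of_iff 0 _ (by simp), ?_, fun n => ?_,
    useful_if_nisanProperty _ _ (useful_nisanProperty _)⟩
  · refine constructive_of_iff (2 ^ 15) _ fun n f => ?_
    rw [Nat.pow_lt_pow_iff_right (by norm_num)]
    split_ifs with h <;> simp [h]
  · split_ifs with h
    · rw [LargeAt, Set.ncard_univ]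
      linarith [(Nat.cast_nonneg (Nat.card (BoolFn n)) : (0 : ℝ) ≤ _)]
    · exact large_nisanProperty _ (not_lt.1 h)
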